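/- **Conventions.** A *dagger theory* is a symmetric monoidal category $(\mathcal C,\otimes,I)$ with a dagger (an identity-on-objects, involutive, contravariant functor $f\mapsto f^\dagger$ with $(f\otimes g)^\dagger=f^\dagger\otimes g^\dagger$ and with unitary coherence isomorphisms), and with a chosen effect $\top_A\colon A\to I$ on each object such that $\top_I=\mathrm{id}_I$ and $\top_{A\otimes B}=\top_A\otimes\top_B$ (up to $I\otimes I\cong I$). We assume that it has zero morphisms, with $0\circ f=0$, $f\circ 0=0$, $0\otimes f=0$. Morphisms $I\to A$, $A\to I$, $I\to I$ are *states*, *effects* and *scalars*. A morphism $f$ is *causal* if $\top\circ f=\top$, an *isometry* if $f^\dagger f=\mathrm{id}$, *unitary* if also $ff^\dagger=\mathrm{id}$, *positive* if $f=g^\dagger g$ for some $g$; morphisms $f,g$ with the same codomain are *orthogonal* if $g^\dagger f=0$. A dagger symmetric monoidal category is *dagger compact* if for every $A$ there are an object $A^*$ and a state $\cup\colon I\to A^*\otimes A$ such that $\cup$ and $\cap=\cup^\dagger\circ\sigma\colon A\otimes A^*\to I$ satisfy the two snake equations ($\sigma$ being the swap); a dagger theory is *compact* if moreover these can be chosen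 with $\top_{A^*}=\cap\circ(\top_A^\dagger\otimes\mathrm{id}_{A^*})$. A *dilation* of $f\colon A\to B$ is a $g\colon A\to B\otimes E$ with $(\mathrm{id}_B\otimes\top_E)\circ g=f$. A morphism $f$ is *pure* if $f=0$ or every dilation of $f$ is of the form $f\otimes\rho$ with $\rho$ a causal state. A *dagger kernel* of $f$ is an isometry $k$ with $fk=0$ through which every $g$ with $fg=0$ factors; the *complement* $k^\perp$ of a dagger kernel $k$ is a dagger kernel of $k^\dagger$. An object $A$ is *trivial* if $\top_A$ is unitary or $A$ is a zero object. States $\psi,\varphi$ of the same object are *orthonormal* if they are orthogonal isometries. The dagger theory $\mathcal C$ (with zero morphisms) *satisfies the operational principles* if it is compact, has a non-trivial object, and satisfies: 1. *Strong purification.* The pure morphisms form a dagger compact subcategory (containing all objects, identities, coherence isomorphisms and a cup for each object, and closed under $\circ,\otimes,\dagger$); every morphism has a pure dilation; for all pure $f\colon A\to B$, $g\colon A\to D$ one has $f^\dagger f=g^\dagger g\iff\top f=\top g$ (the CP axiom); every non-zero object has a causal pure state; and if $f,g\colon A\to B\otimes E$ are pure with $(\mathrm{id}_B\otimes\top_E)f=(\mathrm{id}_B\otimes\top_E)g$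 then $f=(\mathrm{id}_B\otimes U)g$ for a pure unitary $U$ on $E$. 2. *Kernels.* Every morphism has a dagger kernel, and for every dagger kernel $k\colon K\to A$ the effects $d=\top_K\circ k^\dagger$ and $e=\top_{K^\perp}\circ (k^{\perp})^\dagger$ are total: $df=dg$ and $ef=eg$ imply $\top_Af=\top_Ag$ for all $f,g\colon B\to A$. 3. *Pure exclusion.* For every causal pure state $\psi$ of a non-trivial object there is an effect $e\neq0$ with $e\circ\psi=0$. 4. *Conditioning.* For all orthonormal states $|0\rangle,|1\rangle$ of an object $A$ and all states $\rho,\sigma$ of an object $B$ there is $f\colon A\to B$ with $f|0\rangle=\rho$ and $f|1\rangle=\sigma$. In a dagger category with zero morphisms, a *phased dagger biproduct* of a finite family $(A_i)_i$ is an object $P=A_1\mathbin{\dot\oplus}\cdots\mathbin{\dot\oplus}A_n$ with pairwise orthogonal isometries $\kappa_i\colon A_i\to P$ such that, calling an endomorphism $U$ of $P$ a *phase* if $U\kappa_i=\kappa_i$ for all $i$: (i) for all $f_i\colon A_i\to D$ there is $h\colon P\to D$ with $h\kappa_i=f_i$ for all $i$; (ii) if $h\kappa_i=h'\kappa_i$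 for all $i$, then $h'=hU$ for some phase $U$; (iii) if $U$ is a phase, so is $U^\dagger$. An endomorphism $p$ of $P$ is *diagonal* if for each $i$ there is $p_i\colon A_i\to A_i$ with $p\kappa_i=\kappa_ip_i$. A dagger compact category with zero morphisms has the *superposition properties* if every non-zero object $A$ admits an isometry $I\to A$, every finite family of objects (including the empty one) has a phased dagger biproduct, and for every phased dagger biproduct $A\mathbin{\dot\oplus}B$, every phase $U$ and all positive diagonal endomorphisms $p,q$ of it, $p=q\circ U$ implies $p=q$. **Theorem.** Let $\mathcal C$ be a dagger theory satisfying the operational principles, and let $\mathcal C_{\mathsf{pure}}$ be its category of pure morphisms (with all objects of $\mathcal C$). Then $\mathcal C_{\mathsf{pure}}$ has a phased dagger biproduct $I\mathbin{\dot\oplus}I$ all of whose phases are unitary, and $\mathcal C_{\mathsf{pure}}$ is a dagger compact category with the superposition properties; in particular it has finite phased dagger biproducts. -/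

import Mathlib

open CategoryTheory MonoidalCategory Limits

universe v u

namespace DagTheory

/-- A dagger category: one with an identity-on-objects, involutive, contravariant functor. -/
class DaggerCategory (C : Type u) [Category.{v} C] where
  /-- The dagger of a morphism. -/
  dag : ∀ {X Y : C}, (X ⟶ Y) → (Y ⟶ X)
  dag_id : ∀ X : C, dag (𝟙 X) = 𝟙 X
  dag_comp : ∀ {X Y Z : C} (f : X ⟶ Y) (g : Y ⟶ Z), dag (f ≫ g) = dag g ≫ dag f
  dag_dag : ∀ {X Y : C} (f : X ⟶ Y), dag (dag f) = f

open DaggerCategory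

/-- Compatibility of the dagger with a symmetric monoidal structure: the dagger preserves tensor
products of morphisms, and all the coherence isomorphisms are unitary. -/
class DaggerMonoidal (C : Type u) [Category.{v} C] [MonoidalCategory C] [SymmetricCategory C]
    [DaggerCategory C] : Prop where
  dag_tensor : ∀ {W X Y Z : C} (f : W ⟶ X) (g : Y ⟶ Z), dag (f ⊗ₘ g) = dag f ⊗ₘ dag g
  dag_associator : ∀ X Y Z : C, dag (α_ X Y Z).hom = (α_ X Y Z).inv
  dag_leftUnitor : ∀ X : C, dag (λ_ X).hom = (λ_ X).inv
  dag_rightUnitor : ∀ X : C, dag (ρ_ X).hom = (ρ_ X).inv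
  dag_braiding : ∀ X Y : C, dag (β_ X Y).hom = (β_ X Y).inv

/-- A monoidal category with discarding: a chosen effect on every object, compatible with the
monoidal structure. (No naturality is required.) -/
class Discarding (C : Type u) [Category.{v} C] [MonoidalCategory C] where
  /-- The discarding effect. -/
  discard : ∀ A : C, A ⟶ 𝟙_ C
  discard_unit : discard (𝟙_ C) = 𝟙 (𝟙_ C)
  discard_tensor : ∀ A B : C, discard (A ⊗ B) = (discard A ⊗ₘ discard B) ≫ (λ_ (𝟙_ C)).hom

open Discarding

section Dagger

variable {C : Type u} [Category.{v} C] [DaggerCategory C]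

/-- `f† ∘ f = id`. -/
def IsIsometry {A B : C} (f : A ⟶ B) : Prop := f ≫ dag f = 𝟙 A

/-- An isometry `f` with also `f ∘ f† = id`. -/
def IsUnitary {A B : C} (f : A ⟶ B) : Prop := f ≫ dag f = 𝟙 A ∧ dag f ≫ f = 𝟙 B

/-- Morphisms of the form `g† ∘ g`. -/
def IsPositive {A : C} (p : A ⟶ A) : Prop := ∃ (B : C) (g : A ⟶ B), p = g ≫ dag g

variable [HasZeroMorphisms C]

/-- Orthogonality `g† ∘ f = 0`. -/
def Orthogonal {A B D : C} (f : A ⟶ B) (g : D ⟶ B) : Prop := f ≫ dag g = 0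

/-- `k` is a dagger kernel of `f`. -/
structure IsDaggerKernelOf {K A B : C} (k : K ⟶ A) (f : A ⟶ B) : Prop where
  isometry : IsIsometry k
  comp_eq_zero : k ≫ f = 0
  factors : ∀ {D : C} (g : D ⟶ A), g ≫ f = 0 → ∃ h : D ⟶ K, g = h ≫ k

/-- `k` is a dagger kernel (of some morphism). -/
def IsDaggerKernel {K A : C} (k : K ⟶ A) : Prop :=
  ∃ (B : C) (f : A ⟶ B), IsDaggerKernelOf k f

/-- `l` is a complement `k^⊥ = coker(k)† = ker(k†)` of `k`. -/
def IsComplement {K L A : C} (k : K ⟶ A) (l : L ⟶ A) : Prop := IsDaggerKernelOf l (dag k)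

variable (C) in
/-- Every morphism has a dagger kernel. -/
def HasDaggerKernels : Prop :=
  ∀ {A B : C} (f : A ⟶ B), ∃ (K : C) (k : K ⟶ A), IsDaggerKernelOf k f

/-- `U` is a phase with respect to the family of coprojections `κ`: it preserves each of them. -/
def IsPhase {ι : Type} {A : ι → C} {P : C} (κ : ∀ i, A i ⟶ P) (U : P ⟶ P) : Prop :=
  ∀ i, κ i ≫ U = κ i

/-- A phased dagger biproduct of a family of objects: pairwise orthogonal isometries `κ i` into
`obj`, through which every family of morphisms `A i ⟶ D` factors, uniquely up to a phase,
and such that phases are closed under the dagger. -/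
structure PhasedDaggerBiproduct {ι : Type} (A : ι → C) where
  /-- The underlying object. -/
  obj : C
  /-- The coprojections. -/
  κ : ∀ i, A i ⟶ obj
  isometry : ∀ i, IsIsometry (κ i)
  orthogonal : ∀ i j, i ≠ j → Orthogonal (κ i) (κ j)
  exists_desc : ∀ {D : C} (f : ∀ i, A i ⟶ D), ∃ h : obj ⟶ D, ∀ i, κ i ≫ h = f i
  unique_up_to_phase : ∀ {D : C} (h h' : obj ⟶ D), (∀ i, κ i ≫ h = κ i ≫ h') →
    ∃ U : obj ⟶ obj, IsPhase κ U ∧ h' = U ≫ h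
  dag_phase : ∀ U : obj ⟶ obj, IsPhase κ U → IsPhase κ (dag U)

/-- A binary phased dagger biproduct of `A` and `B`: one of the two-element family `![A, B]`. -/
abbrev BinaryPhasedDaggerBiproduct (A B : C) := PhasedDaggerBiproduct ![A, B]

variable (C) in
/-- Every finite family of objects (the empty one included) has a phased dagger biproduct. -/
def HasFinitePhasedDaggerBiproducts : Prop :=
  ∀ (n : ℕ) (A : Fin n → C), Nonempty (PhasedDaggerBiproduct A)

/-- Diagonal morphisms between phased dagger biproducts of families with the same index type. -/
def IsDiagonal {ι : Type} {A B : ι → C} (P : PhasedDaggerBiproduct A)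
    (Q : PhasedDaggerBiproduct B) (f : P.obj ⟶ Q.obj) : Prop :=
  ∀ i, ∃ fi : A i ⟶ B i, P.κ i ≫ f = fi ≫ Q.κ i

end Dagger

section Compact

variable {C : Type u} [Category.{v} C] [MonoidalCategory C] [SymmetricCategory C]
  [DaggerCategory C]

/-- The cap `cup† ∘ σ` belonging to a cup. -/
def cap {A D : C} (cup : 𝟙_ C ⟶ D ⊗ A) : A ⊗ D ⟶ 𝟙_ C := (β_ A D).hom ≫ dag cup

/-- The two snake equations: `cup : I ⟶ D ⊗ A` exhibits `D` as a dagger dual `A^*` of `A`. -/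
structure IsDaggerDual {A D : C} (cup : 𝟙_ C ⟶ D ⊗ A) : Prop where
  snake : A ◁ cup ≫ (α_ A D A).inv ≫ cap cup ▷ A = (ρ_ A).hom ≫ (λ_ A).inv
  snake' : cup ▷ D ≫ (α_ D A D).hom ≫ D ◁ cap cup = (λ_ D).hom ≫ (ρ_ D).inv

variable (C) in
/-- Dagger compactness: every object has a dagger dual. -/
def IsDaggerCompact : Prop := ∀ A : C, ∃ (D : C) (cup : 𝟙_ C ⟶ D ⊗ A), IsDaggerDual cup

variable (C) in
/-- Compactness of a dagger theory: every object `A` has a dagger dual `A^*`, such that discarding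
`A^*` is the effect obtained by bending the state `discard A†` of `A`. -/
def IsCompactTheory [Discarding C] : Prop :=
  ∀ A : C, ∃ (D : C) (cup : 𝟙_ C ⟶ D ⊗ A), IsDaggerDual cup ∧
    discard D = (λ_ D).inv ≫ dag (discard A) ▷ D ≫ cap cup

variable (C) in
/-- Every non-zero object has an isometric state. -/
def IsStateInhabited : Prop := ∀ A : C, ¬ IsZero A → ∃ ψ : 𝟙_ C ⟶ A, IsIsometry ψ

variable (C) in
/-- The monoidal compatibility law `0 ⊗ f = 0` of zero morphisms. -/
def ZeroTensor [HasZeroMorphisms C] : Prop :=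
  ∀ {W X Y Z : C} (f : Y ⟶ Z), (0 : W ⟶ X) ⊗ₘ f = 0

variable (C) in
/-- The superposition properties of a dagger (symmetric) monoidal category with zero morphisms. -/
structure SuperpositionProperties [DaggerMonoidal C] [HasZeroMorphisms C] : Prop where
  zero_tensor : ZeroTensor C
  compact : IsDaggerCompact C
  state_inhabited : IsStateInhabited C
  finite_biproducts : HasFinitePhasedDaggerBiproducts C
  /-- For positive diagonal `p`, `q` on `A ∔ B` and a phase `U`: `p = q ∘ U` implies `p = q`. -/
  positive_cancellation : ∀ {A B : C} (P : BinaryPhasedDaggerBiproduct A B)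
    (U p q : P.obj ⟶ P.obj), IsPhase P.κ U → IsPositive p → IsPositive q →
    IsDiagonal P P p → IsDiagonal P P q → p = U ≫ q → p = q

end Compact

section Theory

variable {C : Type u} [Category.{v} C] [MonoidalCategory C] [SymmetricCategory C]
  [DaggerCategory C] [Discarding C]

/-- `f` is causal: it commutes with discarding. -/
def IsCausal {A B : C} (f : A ⟶ B) : Prop := f ≫ discard B = discard A

/-- `g : A ⟶ B ⊗ E` is a dilation of `f : A ⟶ B`: discarding `E` gives `f`. -/
def IsDilation {A B E : C} (g : A ⟶ B ⊗ E) (f : A ⟶ B) : Prop :=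
  g ≫ B ◁ discard E ≫ (ρ_ B).hom = f

variable (C) in
/-- The pure morphisms: `f` is pure when it is zero, or every dilation of it is of the form
`f ⊗ ρ` for a causal state `ρ`. -/
def pureMorphisms [HasZeroMorphisms C] : MorphismProperty C := fun A B f =>
  f = 0 ∨ ∀ {E : C} (g : A ⟶ B ⊗ E), IsDilation g f →
    ∃ ρ : 𝟙_ C ⟶ E, IsCausal ρ ∧ g = f ≫ (ρ_ B).inv ≫ B ◁ ρ

/-- `P` is a (wide) dagger compact subcategory: closed under composition, tensor and dagger, and
containing identities, the coherence isomorphisms, and a cup for every object. -/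
class IsDaggerCompactSubcategory {C : Type u} [Category.{v} C] [MonoidalCategory C]
    [SymmetricCategory C] [DaggerCategory C] (P : MorphismProperty C) : Prop
    extends P.IsStableUnderBraiding where
  dag_mem : ∀ {A B : C} (f : A ⟶ B), P f → P (dag f)
  exists_cup : ∀ A : C, ∃ (D : C) (cup : 𝟙_ C ⟶ D ⊗ A), IsDaggerDual cup ∧ P cup

/-- `P` is an environment structure: a dagger compact subcategory in which every morphism has a
dilation, and which satisfies the CP axiom. -/
structure IsEnvironmentStructure (P : MorphismProperty C) : Prop where
  subcategory : IsDaggerCompactSubcategory P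
  exists_dilation : ∀ {A B : C} (f : A ⟶ B), ∃ (E : C) (g : A ⟶ B ⊗ E), P g ∧ IsDilation g f
  cp : ∀ {A B D : C} (f : A ⟶ B) (g : A ⟶ D), P f → P g →
    (f ≫ dag f = g ≫ dag g ↔ f ≫ discard B = g ≫ discard D)

variable [HasZeroMorphisms C]

variable (C) in
/-- Strong purification. -/
structure StrongPurification : Prop where
  environment : IsEnvironmentStructure (pureMorphisms C)
  exists_causal_pure_state : ∀ A : C, ¬ IsZero A →
    ∃ ψ : 𝟙_ C ⟶ A, pureMorphisms C ψ ∧ IsCausal ψ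
  /-- Purifications of the same type are essentially unique. -/
  essential_uniqueness : ∀ {A B E : C} (f g : A ⟶ B ⊗ E), pureMorphisms C f → pureMorphisms C g →
    f ≫ B ◁ discard E = g ≫ B ◁ discard E →
    ∃ U : E ⟶ E, pureMorphisms C U ∧ IsUnitary U ∧ f = g ≫ B ◁ U

/-- A pair of effects is total when it determines the result of discarding. -/
def IsTotalPair {A : C} (d e : A ⟶ 𝟙_ C) : Prop :=
  ∀ {B : C} (f g : B ⟶ A), f ≫ d = g ≫ d → f ≫ e = g ≫ e → f ≫ discard A = g ≫ discard A

variable (C) in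
/-- The category has dagger kernels, and these are causally complemented. -/
structure KernelPrinciple : Prop where
  has_kernels : HasDaggerKernels C
  causally_complemented : ∀ {K L A : C} (k : K ⟶ A) (l : L ⟶ A), IsDaggerKernel k →
    IsComplement k l → IsTotalPair (dag k ≫ discard K) (dag l ≫ discard L)

/-- An object is trivial when discarding it is unitary or it is a zero object. -/
def IsTrivialObj (A : C) : Prop := IsUnitary (discard A) ∨ IsZero A

variable (C) in
/-- Every causal pure state of a non-trivial object is excluded by some non-zero effect. -/
def PureExclusion : Prop :=
  ∀ {A : C}, ¬ IsTrivialObj A → ∀ ψ : 𝟙_ C ⟶ A, pureMorphisms C ψ → IsCausal ψ →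
    ∃ e : A ⟶ 𝟙_ C, e ≠ 0 ∧ ψ ≫ e = 0

/-- Orthonormal pairs of states. -/
def IsOrthonormal {A : C} (ψ φ : 𝟙_ C ⟶ A) : Prop :=
  IsIsometry ψ ∧ IsIsometry φ ∧ Orthogonal ψ φ

variable (C) in
/-- For orthonormal states of `A` and any two states of `B`, some morphism `A ⟶ B` sends the former
to the latter. -/
def Conditioning : Prop :=
  ∀ {A B : C} (ψ φ : 𝟙_ C ⟶ A), IsOrthonormal ψ φ → ∀ ρ σ : 𝟙_ C ⟶ B,
    ∃ f : A ⟶ B, ψ ≫ f = ρ ∧ φ ≫ f = σ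

end Theory

/-- The operational principles for a dagger theory with zero morphisms. -/
class OperationalPrinciples (C : Type u) [Category.{v} C] [MonoidalCategory C]
    [SymmetricCategory C] [DaggerCategory C] [DaggerMonoidal C] [Discarding C]
    [HasZeroMorphisms C] : Prop where
  nontrivial : ∃ A : C, ¬ IsTrivialObj A
  compact : IsCompactTheory C
  zero_tensor : ZeroTensor C
  strong_purification : StrongPurification C
  kernels : KernelPrinciple C
  pure_exclusion : PureExclusion C
  conditioning : Conditioning C

/-! The dagger monoidal structure of a dagger compact subcategory (its symmetric monoidal structure
is the one that Mathlib puts on a `WideSubcategory`). -/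

section Wide

variable {C : Type u} [Category.{v} C] [MonoidalCategory C] [SymmetricCategory C]
  [DaggerCategory C] (P : MorphismProperty C) [IsDaggerCompactSubcategory P]

instance wideDaggerCategory : DaggerCategory (WideSubcategory P) where
  dag f := ⟨dag f.hom, IsDaggerCompactSubcategory.dag_mem _ f.property⟩
  dag_id _ := by ext; exact dag_id _
  dag_comp _ _ := by ext; exact dag_comp _ _
  dag_dag _ := by ext; exact dag_dag _

instance wideDaggerMonoidal [DaggerMonoidal C] : DaggerMonoidal (WideSubcategory P) where
  dag_tensor _ _ := by ext; exact DaggerMonoidal.dag_tensor _ _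
  dag_associator _ _ _ := by ext; exact DaggerMonoidal.dag_associator _ _ _
  dag_leftUnitor _ := by ext; exact DaggerMonoidal.dag_leftUnitor _
  dag_rightUnitor _ := by ext; exact DaggerMonoidal.dag_rightUnitor _
  dag_braiding _ _ := by ext; exact DaggerMonoidal.dag_braiding _ _

end Wide

section Pure

variable (C : Type u) [Category.{v} C] [MonoidalCategory C] [SymmetricCategory C]
  [DaggerCategory C] [DaggerMonoidal C] [Discarding C] [HasZeroMorphisms C]
  [OperationalPrinciples C]

instance pureSubcategory : IsDaggerCompactSubcategory (pureMorphisms C) :=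
  OperationalPrinciples.strong_purification.environment.subcategory

/-- The category `C_pure` of pure morphisms, with all objects of `C`. -/
abbrev PureCat := WideSubcategory (pureMorphisms C)

instance pureHasZeroMorphisms : HasZeroMorphisms (PureCat C) where
  zero X Y := ⟨⟨(0 : X.obj ⟶ Y.obj), Or.inl rfl⟩⟩
  comp_zero f Z := by ext; exact comp_zero (C := C) (f := f.hom)
  zero_comp X {_ _} f := by ext; exact zero_comp (C := C) (f := f.hom)

end Pure

end DagTheory

/-!
# Superpositions from operational principles

In a dagger theory satisfying the operational principles, pure morphisms have phased dagger
biproducts. The argument first finds a *qubit*: an object `Q` with two orthonormal pure states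
`|0⟩`, `|1⟩` that jointly detect zero. Causal complementation of kernels then says that the effects
`⟨0|`, `⟨1|` together determine discarding on `Q`. Combined with the CP axiom and the essential
uniqueness of purifications, this makes every phase unitary: the dagger of a phase is causal and
pure, hence unitary.

*Existence of superpositions.* The heart of the matter is a pure effect on `Q` with value `1` on both
`|0⟩` and `|1⟩` (`IsComplementary.exists_plus`). A purification `Ψ` of the completely mixed state has
the form `|0⟩ c₀ + |1⟩ c₁`, so its dagger has value `1` on the orthonormal pair `|i⟩ ⊗ cᵢ`; since
unitaries act transitively on pure states and preserve complements, this pair can be rotated to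
`|i⟩ ⊗ (constant)`. Hence every orthonormal pair of pure states has such an effect. Conditioning and
purification now give, for pure states `f₀`, `f₁`, a pure morphism `|i⟩ ↦ fᵢ ⊗ |i⟩ ⊗ cᵢ`, and an
effect of this kind erases the orthonormal pair `|i⟩ ⊗ cᵢ`, leaving `|i⟩ ↦ fᵢ`
(`IsComplementary.exists_pure_desc`). For this `cᵢ` has to be pure, which rests on the normalisation
of pure states (`IsPure.exists_normalization`).

*Biproducts.* By transposition the same holds for morphisms out of `Y ⊗ Q`, and `A ∔ B` is cut out
of `(A ⊗ B) ⊗ Q` by a kernel (`exists_pureBiproduct`). Uniqueness up to a phase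
(`IsPureBiproduct.exists_phase`) comes from recording the summand in an ancilla `Q`: two morphisms
that agree on the summands become purifications of one and the same morphism. The same device shows
that discarding after a pure `g : A ∔ B ⟶ Y` whose restrictions to `A` and `B` are orthogonal depends
only on discarding after these restrictions. By the CP axiom a positive diagonal morphism is then
determined by its diagonal entries (`IsPureBiproduct.eq_of_diagonal`), which is the cancellation
property for positive morphisms.
-/

set_option linter.unusedSectionVars false

namespace DagTheory

open DaggerCategory Discarding

/-! ### Daggers, isometries and kernels -/

section Dagger

variable {C : Type u} [Category.{v} C] [DaggerCategory C]

attribute [simp] dag_id dag_comp dag_dag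

lemma dag_injective {A B : C} {f g : A ⟶ B} (h : dag f = dag g) : f = g := by
  rw [← dag_dag f, h, dag_dag]

lemma IsIsometry.comp {A B D : C} {f : A ⟶ B} {g : B ⟶ D} (hf : IsIsometry f)
    (hg : IsIsometry g) : IsIsometry (f ≫ g) := by
  unfold IsIsometry at *
  rw [dag_comp, Category.assoc, ← Category.assoc g, hg, Category.id_comp, hf]

lemma isIsometry_id (A : C) : IsIsometry (𝟙 A) := by simp [IsIsometry]

lemma IsIsometry.cancel {A B D : C} {k : A ⟶ B} (hk : IsIsometry k) (g : A ⟶ D) :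
    k ≫ dag k ≫ g = g := by
  rw [← Category.assoc, hk, Category.id_comp]

lemma IsUnitary.dag {A B : C} {f : A ⟶ B} (hf : IsUnitary f) : IsUnitary (dag f) := by
  obtain ⟨h1, h2⟩ := hf
  exact ⟨by simpa using h2, by simpa using h1⟩

variable [HasZeroMorphisms C]

@[simp]
lemma dag_zero (A B : C) : dag (0 : A ⟶ B) = 0 := by
  have h : (0 : A ⟶ B) = (0 : A ⟶ A) ≫ dag (0 : B ⟶ A) := zero_comp.symm
  rw [h, dag_comp, dag_dag, zero_comp]

lemma dag_eq_zero {A B : C} {f : A ⟶ B} (h : dag f = 0) : f = 0 :=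
  dag_injective (h.trans (dag_zero A B).symm)

lemma IsIsometry.ne_zero {A B : C} {f : A ⟶ B} (hf : IsIsometry f) (hA : ¬ IsZero A) :
    f ≠ 0 := by
  rintro rfl
  exact hA ((IsZero.iff_id_eq_zero A).2 (by rw [← hf, zero_comp]))

lemma Orthogonal.symm {A B D : C} {f : A ⟶ B} {g : D ⟶ B} (h : Orthogonal f g) :
    Orthogonal g f := by
  have := congrArg dag h
  simpa [Orthogonal] using this

namespace IsDaggerKernelOf

variable {K A B : C} {k : K ⟶ A} {f : A ⟶ B}

/-- The factorisation through a dagger kernel is given by its dagger. -/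
lemma factor (hk : IsDaggerKernelOf k f) {D : C} {g : D ⟶ A} (hg : g ≫ f = 0) :
    (g ≫ dag k) ≫ k = g := by
  obtain ⟨h, rfl⟩ := hk.factors g hg
  rw [Category.assoc h, hk.isometry, Category.comp_id]

end IsDaggerKernelOf

end Dagger

/-! ### Preparing an ancilla and testing it with an effect -/

section Ancilla

variable {C : Type u} [Category.{v} C] [MonoidalCategory C]

/-- Prepare an ancilla in the state `ρ`: the morphism `id ⊗ ρ : A ⟶ A ⊗ E`. -/
def prep (A : C) {E : C} (ρ : 𝟙_ C ⟶ E) : A ⟶ A ⊗ E := (ρ_ A).inv ≫ A ◁ ρ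

/-- Test the ancilla with the effect `e`: the morphism `id ⊗ e : A ⊗ E ⟶ A`. -/
def test (A : C) {E : C} (e : E ⟶ 𝟙_ C) : A ⊗ E ⟶ A := A ◁ e ≫ (ρ_ A).hom

lemma prep_naturality {A B E : C} (f : A ⟶ B) (ρ : 𝟙_ C ⟶ E) :
    prep A ρ ≫ f ▷ E = f ≫ prep B ρ := by
  rw [prep, prep, Category.assoc, whisker_exchange, ← Category.assoc, ← Category.assoc,
    rightUnitor_inv_naturality]

lemma prep_naturality_assoc {A B E D : C} (f : A ⟶ B) (ρ : 𝟙_ C ⟶ E) (h : B ⊗ E ⟶ D) :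
    prep A ρ ≫ f ▷ E ≫ h = f ≫ prep B ρ ≫ h := by
  rw [← Category.assoc, prep_naturality, Category.assoc]

lemma test_naturality {A B E : C} (f : A ⟶ B) (e : E ⟶ 𝟙_ C) :
    f ▷ E ≫ test B e = test A e ≫ f := by
  rw [test, test, ← Category.assoc, ← whisker_exchange, Category.assoc, Category.assoc,
    rightUnitor_naturality]

lemma prep_whiskerLeft (A : C) {E F : C} (ρ : 𝟙_ C ⟶ E) (g : E ⟶ F) :
    prep A ρ ≫ A ◁ g = prep A (ρ ≫ g) := by
  simp [prep]

lemma whiskerLeft_test (A : C) {E F : C} (g : E ⟶ F) (e : F ⟶ 𝟙_ C) :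
    A ◁ g ≫ test A e = test A (g ≫ e) := by
  simp [test]

lemma prep_test (A : C) {E : C} (ρ : 𝟙_ C ⟶ E) (e : E ⟶ 𝟙_ C) :
    prep A ρ ≫ test A e = (ρ_ A).inv ≫ A ◁ (ρ ≫ e) ≫ (ρ_ A).hom := by
  simp [prep, test]

lemma prep_test_of_eq_id (A : C) {E : C} {ρ : 𝟙_ C ⟶ E} {e : E ⟶ 𝟙_ C} (h : ρ ≫ e = 𝟙 _) :
    prep A ρ ≫ test A e = 𝟙 A := by
  simp [prep_test, h]

/-- Preparing and testing an ancilla multiplies a state by the scalar `ρ ≫ e`. -/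
lemma state_prep_test {X E : C} (f : 𝟙_ C ⟶ X) (ρ : 𝟙_ C ⟶ E) (e : E ⟶ 𝟙_ C) :
    f ≫ prep X ρ ≫ test X e = (ρ ≫ e) ≫ f := by
  rw [← prep_naturality_assoc, test_naturality, ← Category.assoc, prep_test]
  congr 1
  rw [← unitors_inv_equal, ← unitors_equal]
  simp [id_whiskerLeft]

/-- A product state can be prepared in either order. -/
lemma state_prep_comm {X E : C} (f : 𝟙_ C ⟶ X) (ρ : 𝟙_ C ⟶ E) :
    f ≫ prep X ρ = ρ ≫ (λ_ E).inv ≫ f ▷ E := by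
  rw [← prep_naturality]
  rw [prep, ← unitors_inv_equal, ← leftUnitor_inv_naturality, Category.assoc]

lemma state_prep_comm_assoc {X E D : C} (f : 𝟙_ C ⟶ X) (ρ : 𝟙_ C ⟶ E) (h : X ⊗ E ⟶ D) :
    f ≫ prep X ρ ≫ h = ρ ≫ (λ_ E).inv ≫ f ▷ E ≫ h := by
  rw [← Category.assoc, state_prep_comm, Category.assoc, Category.assoc]

/-- A product effect can be tested in either order. -/
lemma test_effect_comm {X E : C} (f : X ⟶ 𝟙_ C) (e : E ⟶ 𝟙_ C) :
    test X e ≫ f = f ▷ E ≫ (λ_ E).hom ≫ e := by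
  rw [← test_naturality]
  rw [test, ← unitors_equal, leftUnitor_naturality]

lemma prep_prep (A : C) {E F : C} (ρ : 𝟙_ C ⟶ E) (σ : 𝟙_ C ⟶ F) :
    prep A ρ ≫ prep (A ⊗ E) σ ≫ (α_ A E F).hom = prep A (ρ ≫ prep E σ) := by
  simp [prep]

end Ancilla

section DaggerAncilla

variable {C : Type u} [Category.{v} C] [MonoidalCategory C] [SymmetricCategory C]
  [DaggerCategory C] [DaggerMonoidal C]

open DaggerMonoidal

@[simp]
lemma dag_rightUnitor_inv (X : C) : dag (ρ_ X).inv = (ρ_ X).hom := by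
  rw [← dag_rightUnitor, dag_dag]

@[simp]
lemma dag_whiskerLeft (A : C) {X Y : C} (f : X ⟶ Y) : dag (A ◁ f) = A ◁ dag f := by
  rw [← id_tensorHom, dag_tensor, dag_id, id_tensorHom]

@[simp]
lemma dag_whiskerRight {X Y : C} (f : X ⟶ Y) (A : C) : dag (f ▷ A) = dag f ▷ A := by
  rw [← tensorHom_id, dag_tensor, dag_id, tensorHom_id]

@[simp]
lemma dag_prep (A : C) {E : C} (ρ : 𝟙_ C ⟶ E) : dag (prep A ρ) = test A (dag ρ) := by
  simp [prep, test]

lemma IsIsometry.prep (A : C) {E : C} {ρ : 𝟙_ C ⟶ E} (h : IsIsometry ρ) :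
    IsIsometry (prep A ρ) := by
  unfold IsIsometry
  rw [dag_prep, prep_test_of_eq_id A h]

end DaggerAncilla

/-! ### Zero morphisms, purity and transposition -/

section Theory

variable {C : Type u} [Category.{v} C] [MonoidalCategory C] [SymmetricCategory C]
  [DaggerCategory C] [DaggerMonoidal C] [Discarding C] [HasZeroMorphisms C]
  [OperationalPrinciples C]

lemma zero_whiskerRight {X Y : C} (A : C) : (0 : X ⟶ Y) ▷ A = 0 := by
  rw [← tensorHom_id, OperationalPrinciples.zero_tensor]

lemma whiskerLeft_zero {X Y : C} (A : C) : A ◁ (0 : X ⟶ Y) = 0 := by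
  have h := BraidedCategory.braiding_naturality_right A (0 : X ⟶ Y)
  rw [zero_whiskerRight, comp_zero] at h
  rw [← cancel_mono (β_ A Y).hom, h, zero_comp]

lemma prep_zero (A E : C) : prep A (0 : 𝟙_ C ⟶ E) = 0 := by
  simp [prep, whiskerLeft_zero]

lemma test_zero (A E : C) : test A (0 : E ⟶ 𝟙_ C) = 0 := by
  simp [test, whiskerLeft_zero]

lemma prep_test_of_eq_zero (A : C) {E : C} {ρ : 𝟙_ C ⟶ E} {e : E ⟶ 𝟙_ C} (h : ρ ≫ e = 0) :
    prep A ρ ≫ test A e = 0 := by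
  simp [prep_test, h, whiskerLeft_zero]

/-- `f` is a pure morphism. -/
def IsPure {A B : C} (f : A ⟶ B) : Prop := pureMorphisms C f

namespace IsPure

lemma zero (A B : C) : IsPure (0 : A ⟶ B) := Or.inl rfl

lemma id (A : C) : IsPure (𝟙 A) := (pureMorphisms C).id_mem A

lemma comp {A B D : C} {f : A ⟶ B} {g : B ⟶ D} (hf : IsPure f) (hg : IsPure g) :
    IsPure (f ≫ g) := (pureMorphisms C).comp_mem f g hf hg

lemma dag {A B : C} {f : A ⟶ B} (hf : IsPure f) : IsPure (dag f) :=
  IsDaggerCompactSubcategory.dag_mem (P := pureMorphisms C) f hf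

lemma whiskerLeft (A : C) {X Y : C} {f : X ⟶ Y} (hf : IsPure f) : IsPure (A ◁ f) :=
  (pureMorphisms C).whiskerLeft_mem A f hf

lemma whiskerRight {X Y : C} {f : X ⟶ Y} (hf : IsPure f) (A : C) : IsPure (f ▷ A) :=
  (pureMorphisms C).whiskerRight_mem f hf A

lemma leftUnitor_hom (A : C) : IsPure (λ_ A).hom :=
  MorphismProperty.leftUnitor_hom_mem (pureMorphisms C) A

lemma leftUnitor_inv (A : C) : IsPure (λ_ A).inv :=
  MorphismProperty.leftUnitor_inv_mem (pureMorphisms C) A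

lemma rightUnitor_hom (A : C) : IsPure (ρ_ A).hom :=
  MorphismProperty.rightUnitor_hom_mem (pureMorphisms C) A

lemma rightUnitor_inv (A : C) : IsPure (ρ_ A).inv :=
  MorphismProperty.rightUnitor_inv_mem (pureMorphisms C) A

lemma associator_hom (A B D : C) : IsPure (α_ A B D).hom :=
  MorphismProperty.associator_hom_mem (pureMorphisms C) A B D

lemma associator_inv (A B D : C) : IsPure (α_ A B D).inv :=
  MorphismProperty.associator_inv_mem (pureMorphisms C) A B D

lemma braiding (A B : C) : IsPure (β_ A B).hom :=
  MorphismProperty.braiding_hom_mem (pureMorphisms C) A B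

lemma prep (A : C) {E : C} {ρ : 𝟙_ C ⟶ E} (h : IsPure ρ) : IsPure (prep A ρ) :=
  (rightUnitor_inv A).comp (h.whiskerLeft A)

lemma test (A : C) {E : C} {e : E ⟶ 𝟙_ C} (h : IsPure e) : IsPure (test A e) :=
  (h.whiskerLeft A).comp (rightUnitor_hom A)

end IsPure

/-- Every object has a dual with pure unit and counit. -/
lemma exists_pure_dual (A : C) : ∃ (D : C) (_ : ExactPairing D A),
    IsPure (η_ D A) ∧ IsPure (ε_ D A) := by
  obtain ⟨D, cup, hcup, hp⟩ := IsDaggerCompactSubcategory.exists_cup (P := pureMorphisms C) A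
  have hp' : IsPure cup := hp
  exact ⟨D, ⟨cup, cap cup, hcup.snake, hcup.snake'⟩, hp', (IsPure.braiding A D).comp hp'.dag⟩

lemma exists_pure_dual' (A : C) : ∃ (D : C) (_ : ExactPairing A D),
    IsPure (η_ A D) ∧ IsPure (ε_ A D) := by
  obtain ⟨D, i, h1, h2⟩ := exists_pure_dual A
  refine ⟨D, BraidedCategory.exactPairing_swap D A, ?_, ?_⟩
  · have h : IsPure (η_ D A ≫ (β_ A D).inv) := by
      rw [← SymmetricCategory.braiding_swap_eq_inv_braiding]
      exact h1.comp (IsPure.braiding D A)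
    exact h
  · exact (IsPure.braiding D A).comp h2

section Transpose

variable {Y Y' X Z : C} [ExactPairing Y Y']

lemma IsPure.transpose (h : IsPure (η_ Y Y')) {f : Y' ⊗ X ⟶ Z} (hf : IsPure f) :
    IsPure (tensorLeftHomEquiv X Y Y' Z f) :=
  (leftUnitor_inv _).comp ((h.whiskerRight _).comp
    ((associator_hom _ _ _).comp (hf.whiskerLeft _)))

lemma IsPure.transpose_symm (h : IsPure (ε_ Y Y')) {f : X ⟶ Y ⊗ Z} (hf : IsPure f) :
    IsPure ((tensorLeftHomEquiv X Y Y' Z).symm f) :=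
  (hf.whiskerLeft _).comp ((associator_inv _ _ _).comp
    ((h.whiskerRight _).comp (leftUnitor_hom _)))

lemma transpose_eq_zero {f : Y' ⊗ X ⟶ Z} : tensorLeftHomEquiv X Y Y' Z f = 0 ↔ f = 0 := by
  have h0 : tensorLeftHomEquiv X Y Y' Z 0 = 0 := by
    simp [tensorLeftHomEquiv, whiskerLeft_zero]
  rw [← h0, Equiv.apply_eq_iff_eq]

lemma transpose_symm_eq_zero {f : X ⟶ Y ⊗ Z} :
    (tensorLeftHomEquiv X Y Y' Z).symm f = 0 ↔ f = 0 := by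
  rw [← transpose_eq_zero (Y := Y) (Y' := Y'), Equiv.apply_symm_apply]

end Transpose

/-- Tensoring with an identity preserves dagger kernels. -/
lemma IsDaggerKernelOf.whiskerLeft (Y : C) {K A B : C} {k : K ⟶ A} {f : A ⟶ B}
    (hk : IsDaggerKernelOf k f) : IsDaggerKernelOf (Y ◁ k) (Y ◁ f) where
  isometry := by
    unfold IsIsometry
    rw [dag_whiskerLeft, ← MonoidalCategory.whiskerLeft_comp, hk.isometry, whiskerLeft_id]
  comp_eq_zero := by
    rw [← MonoidalCategory.whiskerLeft_comp, hk.comp_eq_zero, whiskerLeft_zero]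
  factors {D} g hg := by
    obtain ⟨Y', i, -, -⟩ := exists_pure_dual' Y
    obtain ⟨g, rfl⟩ := (tensorLeftHomEquiv D Y Y' A).surjective g
    rw [← tensorLeftHomEquiv_naturality, transpose_eq_zero] at hg
    obtain ⟨h, rfl⟩ := hk.factors g hg
    exact ⟨_, tensorLeftHomEquiv_naturality _ _⟩

lemma IsDaggerKernelOf.whiskerRight {K A B : C} {k : K ⟶ A} {f : A ⟶ B}
    (hk : IsDaggerKernelOf k f) (Y : C) : IsDaggerKernelOf (k ▷ Y) (f ▷ Y) where
  isometry := by
    unfold IsIsometry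
    rw [dag_whiskerRight, ← comp_whiskerRight, hk.isometry, id_whiskerRight]
  comp_eq_zero := by
    rw [← comp_whiskerRight, hk.comp_eq_zero, zero_whiskerRight]
  factors {D} g hg := by
    obtain ⟨h, hh⟩ := (hk.whiskerLeft Y).factors (g ≫ (β_ A Y).hom) (by
      rw [Category.assoc, ← BraidedCategory.braiding_naturality_left, ← Category.assoc, hg,
        zero_comp])
    refine ⟨h ≫ (β_ K Y).inv, ?_⟩
    rw [← cancel_mono (β_ A Y).hom, hh, Category.assoc, Category.assoc,
      BraidedCategory.braiding_naturality_left, Iso.inv_hom_id_assoc]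

/-- A total pair of effects on `A` stays total in the presence of a further system `Y`. -/
lemma IsTotalPair.whiskerLeft {A : C} {d e : A ⟶ 𝟙_ C} (h : IsTotalPair d e) {X Y : C}
    {f g : X ⟶ Y ⊗ A} (hd : f ≫ test Y d = g ≫ test Y d) (he : f ≫ test Y e = g ≫ test Y e) :
    f ≫ test Y (discard A) = g ≫ test Y (discard A) := by
  obtain ⟨Y', i, -, -⟩ := exists_pure_dual' Y
  obtain ⟨f, rfl⟩ := (tensorLeftHomEquiv X Y Y' A).surjective f
  obtain ⟨g, rfl⟩ := (tensorLeftHomEquiv X Y Y' A).surjective g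
  simp only [test, ← Category.assoc, cancel_mono, ← tensorLeftHomEquiv_naturality,
    Equiv.apply_eq_iff_eq] at *
  exact h f g hd he

/-- Epimorphism-like cancellation of zero is stable under adding a further system. -/
lemma eq_zero_of_whiskerLeft_comp {A X : C} {c : A ⟶ X}
    (hc : ∀ {Z : C} (e : X ⟶ Z), c ≫ e = 0 → e = 0) {Y Z : C} {v : Y ⊗ X ⟶ Z}
    (h : Y ◁ c ≫ v = 0) : v = 0 := by
  obtain ⟨Y', i, -, -⟩ := exists_pure_dual Y
  obtain ⟨v, rfl⟩ := (tensorLeftHomEquiv X Y' Y Z).symm.surjective v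
  rw [← tensorLeftHomEquiv_symm_naturality, transpose_symm_eq_zero] at h
  rw [transpose_symm_eq_zero]
  exact hc v h

/-! ### Consequences of the kernel and purification principles -/

lemma exists_kernel {A B : C} (f : A ⟶ B) : ∃ (K : C) (k : K ⟶ A), IsDaggerKernelOf k f :=
  OperationalPrinciples.kernels.has_kernels f

lemma exists_pure_dilation {A B : C} (f : A ⟶ B) :
    ∃ (E : C) (g : A ⟶ B ⊗ E), IsPure g ∧ g ≫ test B (discard E) = f :=
  OperationalPrinciples.strong_purification.environment.exists_dilation f

lemma exists_causal_pure_state {A : C} (hA : ¬ IsZero A) :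
    ∃ ψ : 𝟙_ C ⟶ A, IsPure ψ ∧ IsCausal ψ :=
  OperationalPrinciples.strong_purification.exists_causal_pure_state A hA

/-- The CP axiom. -/
lemma IsPure.cp {A B D : C} {f : A ⟶ B} {g : A ⟶ D} (hf : IsPure f) (hg : IsPure g) :
    f ≫ DaggerCategory.dag f = g ≫ DaggerCategory.dag g ↔ f ≫ discard B = g ≫ discard D :=
  OperationalPrinciples.strong_purification.environment.cp f g hf hg

lemma IsPure.isometry_iff_causal {A B : C} {f : A ⟶ B} (hf : IsPure f) :
    IsIsometry f ↔ IsCausal f := by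
  have := hf.cp (IsPure.id A)
  rw [dag_id, Category.id_comp, Category.id_comp] at this
  exact this

lemma IsPure.exists_eq_prep {A B E : C} {f : A ⟶ B} (hf : IsPure f) (h0 : f ≠ 0)
    {g : A ⟶ B ⊗ E} (hg : g ≫ DagTheory.test B (discard E) = f) :
    ∃ ρ : 𝟙_ C ⟶ E, IsCausal ρ ∧ g = f ≫ DagTheory.prep B ρ :=
  (hf.resolve_left h0) g hg

lemma discard_tensor_eq_test (A B : C) : discard (A ⊗ B) = test A (discard B) ≫ discard A := by
  rw [discard_tensor, test, tensorHom_def', Category.assoc, Category.assoc, unitors_equal,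
    rightUnitor_naturality]

lemma eq_zero_of_comp_dag {A B : C} {g : A ⟶ B} (h : g ≫ dag g = 0) : g = 0 := by
  obtain ⟨K, k, hk⟩ := exists_kernel (dag g)
  have h1 := hk.factor h
  have h2 : k ≫ dag g = 0 := hk.comp_eq_zero
  have h3 : g ≫ dag k = 0 := by simpa using congrArg dag h2
  rw [← h1, h3, zero_comp]

/-- Discarding is faithful on zero. -/
lemma eq_zero_of_discard {A B : C} {f : A ⟶ B} (h : f ≫ discard B = 0) : f = 0 := by
  obtain ⟨E, g, hg, rfl⟩ := exists_pure_dilation f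
  rw [Category.assoc, ← discard_tensor_eq_test] at h
  have := (hg.cp (IsPure.zero A B)).2 (by rw [h, zero_comp])
  rw [zero_comp] at this
  rw [eq_zero_of_comp_dag this, zero_comp]

/-- A morphism whose marginal vanishes is zero. -/
lemma eq_zero_of_test_discard {A B E : C} {g : A ⟶ B ⊗ E}
    (h : g ≫ test B (discard E) = 0) : g = 0 := by
  apply eq_zero_of_discard
  rw [discard_tensor_eq_test, ← Category.assoc, h, zero_comp]

/-- Pure morphisms with the same domain, codomain and discarded part differ by a unitary. -/
lemma IsPure.exists_unitary {A E : C} {f g : A ⟶ E} (hf : IsPure f) (hg : IsPure g)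
    (h : f ≫ discard E = g ≫ discard E) :
    ∃ U : E ⟶ E, IsPure U ∧ IsUnitary U ∧ f = g ≫ U := by
  obtain ⟨U, hU, hU', hfg⟩ := OperationalPrinciples.strong_purification.essential_uniqueness
    (f ≫ (λ_ E).inv) (g ≫ (λ_ E).inv) (hf.comp (leftUnitor_inv E)) (hg.comp (leftUnitor_inv E))
    (by rw [Category.assoc, Category.assoc, ← leftUnitor_inv_naturality, ← Category.assoc, h,
      Category.assoc])
  refine ⟨U, hU, hU', ?_⟩
  rw [Category.assoc, ← leftUnitor_inv_naturality, ← Category.assoc, cancel_mono] at hfg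
  exact hfg

/-- Essential uniqueness of purifications. -/
lemma IsPure.exists_unitary_ancilla {A B E : C} {f g : A ⟶ B ⊗ E} (hf : IsPure f) (hg : IsPure g)
    (h : f ≫ DagTheory.test B (discard E) = g ≫ DagTheory.test B (discard E)) :
    ∃ U : E ⟶ E, IsPure U ∧ IsUnitary U ∧ f = g ≫ B ◁ U :=
  OperationalPrinciples.strong_purification.essential_uniqueness f g hf hg (by
    simpa only [DagTheory.test, ← Category.assoc, cancel_mono] using h)

/-- Causal pure endomorphisms are unitary. -/
lemma IsPure.isUnitary_of_causal {A : C} {f : A ⟶ A} (hf : IsPure f) (h : IsCausal f) :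
    IsUnitary f := by
  obtain ⟨U, -, hU, rfl⟩ := hf.exists_unitary (IsPure.id A) (by rw [h, Category.id_comp])
  rwa [Category.id_comp]

/-- Dagger kernels are pure: a dilation of `k` is killed by `f ⊗ id`, since its marginal is, so it
factors through `k ⊗ id` by a dilation of the identity. -/
lemma IsDaggerKernelOf.isPure {K A B : C} {k : K ⟶ A} {f : A ⟶ B}
    (hk : IsDaggerKernelOf k f) : IsPure k := by
  by_cases h0 : k = 0
  · exact Or.inl h0
  refine Or.inr fun {E} g hg => ?_
  change g ≫ DagTheory.test A (discard E) = k at hg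
  have h1 : g ≫ f ▷ E = 0 := by
    apply eq_zero_of_test_discard
    rw [Category.assoc, test_naturality, ← Category.assoc, hg, hk.comp_eq_zero]
  obtain ⟨h, rfl⟩ := (hk.whiskerRight E).factors g h1
  have h2 : h ≫ DagTheory.test K (discard E) = 𝟙 K := by
    rw [Category.assoc, test_naturality, ← Category.assoc] at hg
    have := congrArg (· ≫ dag k) hg
    simp only [Category.assoc] at this
    rw [hk.isometry, Category.comp_id] at this
    exact this
  have hK : 𝟙 K ≠ 0 := fun h => h0 (by rw [← Category.id_comp k, h, zero_comp])
  obtain ⟨ρ, hρ, rfl⟩ := (IsPure.id K).exists_eq_prep hK h2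
  exact ⟨ρ, hρ, by rw [Category.id_comp, prep_naturality]; rfl⟩

end Theory

section Complements

variable {C : Type u} [Category.{v} C] [MonoidalCategory C] [SymmetricCategory C]
  [DaggerCategory C] [DaggerMonoidal C] [Discarding C] [HasZeroMorphisms C]
  [OperationalPrinciples C]

/-! ### States, images and pure isometries -/

lemma isZero_of_isZero_unit (h : IsZero (𝟙_ C)) (A : C) : IsZero A := by
  rw [IsZero.iff_id_eq_zero] at h ⊢
  rw [← (ρ_ A).inv_hom_id, ← Category.id_comp (ρ_ A).hom, ← whiskerLeft_id, h, whiskerLeft_zero,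
    zero_comp, comp_zero]

lemma not_isZero_unit : ¬ IsZero (𝟙_ C) := fun h => by
  obtain ⟨A, hA⟩ := OperationalPrinciples.nontrivial (C := C)
  exact hA (Or.inr (isZero_of_isZero_unit h A))

lemma not_isZero_of_ne_zero {A B : C} {f : A ⟶ B} (h : f ≠ 0) : ¬ IsZero B :=
  fun hB => h (hB.eq_of_tgt _ _)

lemma IsIsometry.state_ne_zero {A : C} {ψ : 𝟙_ C ⟶ A} (h : IsIsometry ψ) : ψ ≠ 0 :=
  h.ne_zero not_isZero_unit

lemma causal_state_iff {A : C} {ψ : 𝟙_ C ⟶ A} : IsCausal ψ ↔ ψ ≫ discard A = 𝟙 _ := by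
  rw [IsCausal, discard_unit]

lemma exists_isometric_pure_state {A : C} (hA : ¬ IsZero A) :
    ∃ ψ : 𝟙_ C ⟶ A, IsPure ψ ∧ IsIsometry ψ := by
  obtain ⟨ψ, h, h'⟩ := exists_causal_pure_state hA
  exact ⟨ψ, h, h.isometry_iff_causal.2 h'⟩

/-- Every morphism factors through a dagger kernel by a morphism with zero cokernel. -/
lemma exists_image {A B : C} (f : A ⟶ B) : ∃ (J : C) (j : J ⟶ B), IsDaggerKernel j ∧
    (f ≫ dag j) ≫ j = f ∧ ∀ {Z : C} (e : J ⟶ Z), (f ≫ dag j) ≫ e = 0 → e = 0 := by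
  obtain ⟨K, c, hc⟩ := exists_kernel (dag f)
  obtain ⟨J, j, hj⟩ := exists_kernel (dag c)
  have h1 : f ≫ dag c = 0 := by simpa using congrArg dag hc.comp_eq_zero
  have h2 : c ≫ dag j = 0 := by simpa using congrArg dag hj.comp_eq_zero
  refine ⟨J, j, ⟨_, _, hj⟩, hj.factor h1, fun {Z} e he => ?_⟩
  have h3 : (dag e ≫ j) ≫ dag f = 0 := by simpa using congrArg dag he
  obtain ⟨h, hh⟩ := hc.factors _ h3
  apply dag_eq_zero
  have h4 : dag e = (dag e ≫ j) ≫ dag j := by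
    rw [Category.assoc, hj.isometry, Category.comp_id]
  rw [h4, hh, Category.assoc, h2, comp_zero]

lemma IsDaggerKernel.isIsometry {K A : C} {k : K ⟶ A} (hk : IsDaggerKernel k) : IsIsometry k := by
  obtain ⟨_, _, h⟩ := hk
  exact h.isometry

lemma IsDaggerKernel.isPure {K A : C} {k : K ⟶ A} (hk : IsDaggerKernel k) : IsPure k := by
  obtain ⟨_, _, h⟩ := hk
  exact h.isPure

/-- Non-trivial objects contain an orthonormal pair of pure states. -/
lemma exists_orthonormal {A : C} (hA : ¬ IsTrivialObj A) :
    ∃ ψ φ : 𝟙_ C ⟶ A, IsPure ψ ∧ IsPure φ ∧ IsOrthonormal ψ φ := by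
  obtain ⟨ψ, h, h'⟩ := exists_causal_pure_state (fun h => hA (Or.inr h))
  obtain ⟨e, he, hψe⟩ := OperationalPrinciples.pure_exclusion hA ψ h h'
  obtain ⟨K, k, hk⟩ := exists_kernel (dag ψ)
  have hK : ¬ IsZero K := by
    intro hK
    obtain ⟨g, hg⟩ := hk.factors (dag e) (by simpa using congrArg dag hψe)
    rw [hK.eq_of_tgt g 0, zero_comp] at hg
    exact he (dag_eq_zero hg)
  obtain ⟨φ, hφ, hφ'⟩ := exists_isometric_pure_state hK
  refine ⟨ψ, φ ≫ k, h, hφ.comp hk.isPure, h.isometry_iff_causal.2 h', hφ'.comp hk.isometry, ?_⟩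
  apply Orthogonal.symm
  rw [Orthogonal, Category.assoc, hk.comp_eq_zero, comp_zero]

/-- Objects whose discarding effect is unitary have only one causal state. -/
lemma state_unique {J : C} (hJ : IsUnitary (discard J)) {ψ : 𝟙_ C ⟶ J} (h : IsCausal ψ) :
    ψ = dag (discard J) := by
  rw [← Category.comp_id ψ, ← hJ.1, ← Category.assoc, causal_state_iff.1 h, Category.id_comp]

/-- By pure exclusion, a causal pure state with zero cokernel lives on a trivial object. -/
lemma isUnitary_discard_of_state {J : C} {ψ : 𝟙_ C ⟶ J} (h : IsPure ψ) (h' : IsCausal ψ)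
    (h0 : ∀ e : J ⟶ 𝟙_ C, ψ ≫ e = 0 → e = 0) : IsUnitary (discard J) := by
  by_contra hJ
  have hJ' : ¬ IsTrivialObj J := by
    rintro (h1 | h1)
    · exact hJ h1
    · exact (h.isometry_iff_causal.2 h').state_ne_zero (h1.eq_of_tgt _ _)
  obtain ⟨e, he, hψe⟩ := OperationalPrinciples.pure_exclusion hJ' ψ h h'
  exact he (h0 e hψe)

/-- Causal pure states are dagger kernels. -/
lemma isDaggerKernel_of_state {A : C} {ψ : 𝟙_ C ⟶ A} (h : IsPure ψ) (h' : IsIsometry ψ) :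
    IsDaggerKernel ψ := by
  obtain ⟨J, j, hj, hfac, h0⟩ := exists_image ψ
  have hp : IsPure (ψ ≫ dag j) := h.comp hj.isPure.dag
  have hc : IsCausal (ψ ≫ dag j) := by
    have h1 : IsCausal j := hj.isPure.isometry_iff_causal.1 hj.isIsometry
    rw [IsCausal] at h1 ⊢
    rw [← h1, ← Category.assoc, hfac]
    exact h.isometry_iff_causal.1 h'
  have hu := isUnitary_discard_of_state hp hc h0
  obtain ⟨B, f, hf⟩ := hj
  refine ⟨B, f, h', by rw [← hfac, Category.assoc, hf.comp_eq_zero, comp_zero], fun {D} g hg => ?_⟩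
  obtain ⟨x, rfl⟩ := hf.factors g hg
  refine ⟨x ≫ discard J, ?_⟩
  conv_rhs => rw [← hfac, state_unique hu hc]
  rw [Category.assoc, ← Category.assoc (discard J), hu.1, Category.id_comp]

/-- Pure isometries are dagger kernels: adjoining a pure state to the codomain or to the domain, an
isometry `A ⟶ X` becomes unitarily equivalent to the kernel `id ⊗ x : A ⟶ A ⊗ X`. -/
lemma IsPure.isDaggerKernel {A X : C} {m : A ⟶ X} (h : IsPure m) (h' : IsIsometry m) :
    IsDaggerKernel m := by
  by_cases hA : IsZero A
  · refine ⟨X, 𝟙 X, h', hA.eq_of_src _ _, fun g hg => ⟨0, ?_⟩⟩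
    rw [zero_comp, ← hg, Category.comp_id]
  obtain ⟨a, ha, ha'⟩ := exists_isometric_pure_state hA
  obtain ⟨x, hx, hx'⟩ := exists_isometric_pure_state (not_isZero_of_ne_zero (h'.ne_zero hA))
  obtain ⟨B, g, hg⟩ := isDaggerKernel_of_state hx hx'
  set n : X ⟶ A ⊗ X := DagTheory.prep X a ≫ (β_ X A).hom with hn
  have hn' : IsIsometry n := (ha'.prep X).comp (by simp [IsIsometry, DaggerMonoidal.dag_braiding])
  have hnp : IsPure n := (ha.prep X).comp (IsPure.braiding X A)
  obtain ⟨U, -, hU, hmU⟩ := (h.comp hnp).exists_unitary (hx.prep A) (by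
    have h1 := (h.comp hnp).isometry_iff_causal.1 (h'.comp hn')
    have h2 := (hx.prep A).isometry_iff_causal.1 (hx'.prep A)
    exact h1.trans h2.symm)
  have hk := hg.whiskerLeft A
  refine ⟨_, n ≫ DaggerCategory.dag U ≫ A ◁ g, h', ?_, fun {Z} y hy => ?_⟩
  · rw [← Category.assoc, hmU, Category.assoc, ← Category.assoc U, hU.1, Category.id_comp,
      prep_whiskerLeft, hg.comp_eq_zero, prep_zero]
  · obtain ⟨z, hz⟩ := hk.factors (y ≫ n ≫ DaggerCategory.dag U) (by simpa using hy)
    refine ⟨z ≫ (ρ_ A).hom, ?_⟩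
    have h3 : y ≫ n = ((z ≫ (ρ_ A).hom) ≫ m) ≫ n := by
      have h4 : y ≫ n = (y ≫ n ≫ DaggerCategory.dag U) ≫ U := by
        rw [Category.assoc, Category.assoc, hU.2, Category.comp_id]
      rw [h4, hz, Category.assoc (z ≫ _), hmU, DagTheory.prep]
      simp
    have h5 := congrArg (· ≫ DaggerCategory.dag n) h3
    simp only [Category.assoc] at h5
    rw [hn'] at h5
    simpa using h5

/-! ### Complementary pairs of isometries -/

/-- Pure isometries `k : A ⟶ P` and `l : B ⟶ P` are complementary when they are orthogonal and
jointly detect zero morphisms out of `P`. -/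
structure IsComplementary {A B P : C} (k : A ⟶ P) (l : B ⟶ P) : Prop where
  pure_left : IsPure k
  pure_right : IsPure l
  isometry_left : IsIsometry k
  isometry_right : IsIsometry l
  orthogonal : k ≫ dag l = 0
  zero_epi : ∀ {D : C} (f : P ⟶ D), k ≫ f = 0 → l ≫ f = 0 → f = 0

namespace IsComplementary

variable {A B P : C} {k : A ⟶ P} {l : B ⟶ P}

lemma symm (h : IsComplementary k l) : IsComplementary l k where
  pure_left := h.pure_right
  pure_right := h.pure_left
  isometry_left := h.isometry_right
  isometry_right := h.isometry_left
  orthogonal := Orthogonal.symm h.orthogonal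
  zero_epi f h1 h2 := h.zero_epi f h2 h1

lemma isComplement (h : IsComplementary k l) : IsComplement k l := by
  obtain ⟨L, k', hk'⟩ := exists_kernel (dag k)
  have hl : (l ≫ dag k') ≫ k' = l := hk'.factor h.symm.orthogonal
  -- `l` factors through the complement of `k` by a pure isometry with zero cokernel, that is, by
  -- a kernel of zero.
  have hiso : IsIsometry (l ≫ dag k') := by
    have := h.isometry_right
    unfold IsIsometry at *
    calc (l ≫ dag k') ≫ dag (l ≫ dag k') = ((l ≫ dag k') ≫ k') ≫ dag l := by simp
      _ = _ := by rw [hl, this]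
  obtain ⟨M, m, hm⟩ := (h.pure_right.comp hk'.isPure.dag).isDaggerKernel hiso
  have hm0 : m = 0 := by
    have h1 : dag k' ≫ m = 0 := by
      apply h.zero_epi
      · have : k ≫ dag k' = 0 := by simpa using congrArg dag hk'.comp_eq_zero
        rw [← Category.assoc, this, zero_comp]
      · rw [← Category.assoc, hm.comp_eq_zero]
    rw [← hk'.isometry.cancel m, h1, comp_zero]
  refine ⟨h.isometry_right, h.symm.orthogonal, fun g hg => ?_⟩
  obtain ⟨x, rfl⟩ := hk'.factors g hg
  obtain ⟨y, rfl⟩ := hm.factors x (by rw [hm0, comp_zero])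
  exact ⟨y, by rw [Category.assoc, hl]⟩

lemma isTotalPair (h : IsComplementary k l) :
    IsTotalPair (dag k ≫ discard A) (dag l ≫ discard B) :=
  OperationalPrinciples.kernels.causally_complemented k l
    (h.pure_left.isDaggerKernel h.isometry_left) h.isComplement

lemma eq_of_comp_left (h : IsComplementary k l) {D : C} {f : P ⟶ D} (hf : k ≫ f = 0) :
    f = dag l ≫ l ≫ f := by
  obtain ⟨x, hx⟩ := h.isComplement.factors (dag f) (by simpa using congrArg dag hf)
  have hx' : f = dag l ≫ dag x := by simpa using congrArg dag hx
  rw [hx', h.isometry_right.cancel]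

lemma eq_of_comp_right (h : IsComplementary k l) {D : C} {f : P ⟶ D} (hf : l ≫ f = 0) :
    f = dag k ≫ k ≫ f := h.symm.eq_of_comp_left hf

/-- Two morphisms that vanish on `l` and agree on `k` are equal. -/
lemma ext_of_comp_right (h : IsComplementary k l) {D : C} {f g : P ⟶ D} (hf : l ≫ f = 0)
    (hg : l ≫ g = 0) (hfg : k ≫ f = k ≫ g) : f = g := by
  rw [h.eq_of_comp_right hf, h.eq_of_comp_right hg, hfg]

end IsComplementary

section States

variable {P : C} {a b : 𝟙_ C ⟶ P}

lemma IsComplementary.isTotalPair_states (h : IsComplementary a b) :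
    IsTotalPair (dag a) (dag b) := by
  intro B f g hf hg
  refine h.isTotalPair f g ?_ ?_ <;> rwa [discard_unit, Category.comp_id]

lemma IsComplementary.isOrthonormal (h : IsComplementary a b) : IsOrthonormal a b :=
  ⟨h.isometry_left, h.isometry_right, h.orthogonal⟩

/-- A complementary pair of states is determined by its first member. -/
lemma IsComplementary.eq_right (h : IsComplementary a b) {c : 𝟙_ C ⟶ P} (hc : IsPure c)
    (hc' : IsIsometry c) (hac : c ≫ dag a = 0) : c = b := by
  obtain ⟨x, rfl⟩ := h.isComplement.factors c hac
  have h1 := causal_state_iff.1 (hc.isometry_iff_causal.1 hc')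
  rw [Category.assoc, causal_state_iff.1 (h.pure_right.isometry_iff_causal.1 h.isometry_right),
    Category.comp_id] at h1
  rw [h1, Category.id_comp]

end States

/-- Orthogonal pure isometries into `X` are complementary in a subobject of `X`. -/
lemma exists_join {A B X : C} {k : A ⟶ X} {l : B ⟶ X} (hk : IsPure k) (hl : IsPure l)
    (hk' : IsIsometry k) (hl' : IsIsometry l) (h : k ≫ dag l = 0) :
    ∃ (P : C) (p : P ⟶ X), IsPure p ∧ IsIsometry p ∧ IsComplementary (k ≫ dag p) (l ≫ dag p) ∧
      (k ≫ dag p) ≫ p = k ∧ (l ≫ dag p) ≫ p = l := by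
  obtain ⟨K, k₀, hk₀⟩ := exists_kernel (dag k)
  obtain ⟨M, m, hm⟩ := exists_kernel (k₀ ≫ dag l)
  obtain ⟨P, p, hp⟩ := exists_kernel (dag (m ≫ k₀))
  have h1 : (k ≫ dag p) ≫ p = k := by
    apply hp.factor
    have : k ≫ dag k₀ = 0 := by simpa using congrArg dag hk₀.comp_eq_zero
    rw [dag_comp, ← Category.assoc, this, zero_comp]
  have h2 : (l ≫ dag p) ≫ p = l := by
    apply hp.factor
    simpa using congrArg dag hm.comp_eq_zero
  have h3 : ∀ {D : C} {n : D ⟶ X}, IsIsometry n → (n ≫ dag p) ≫ p = n →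
      IsIsometry (n ≫ dag p) := by
    intro D n hn hnp
    unfold IsIsometry at *
    calc (n ≫ dag p) ≫ dag (n ≫ dag p) = ((n ≫ dag p) ≫ p) ≫ dag n := by simp
      _ = _ := by rw [hnp, hn]
  refine ⟨P, p, hp.isPure, hp.isometry, ⟨hk.comp hp.isPure.dag, hl.comp hp.isPure.dag,
    h3 hk' h1, h3 hl' h2, ?_, fun {D} f hf1 hf2 => ?_⟩, h1, h2⟩
  · calc (k ≫ dag p) ≫ dag (l ≫ dag p) = ((k ≫ dag p) ≫ p) ≫ dag l := by simp
      _ = _ := by rw [h1, h]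
  · -- `f†`, seen in `X`, is orthogonal to both `k` and `l`, hence factors through `m ≫ k₀`,
    -- which is orthogonal to `P`.
    have e1 : (dag f ≫ p) ≫ dag k = 0 := by simpa using congrArg dag hf1
    obtain ⟨x, hx⟩ := hk₀.factors _ e1
    have e2 : x ≫ k₀ ≫ dag l = 0 := by
      rw [← Category.assoc, ← hx]
      simpa using congrArg dag hf2
    obtain ⟨y, rfl⟩ := hm.factors x e2
    have e3 : (m ≫ k₀) ≫ dag p = 0 := by simpa using congrArg dag hp.comp_eq_zero
    apply dag_eq_zero
    have e4 : dag f = (dag f ≫ p) ≫ dag p := by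
      rw [Category.assoc, hp.isometry, Category.comp_id]
    rw [e4, hx, Category.assoc, Category.assoc, ← Category.assoc m, e3, comp_zero]

lemma IsComplementary.isUnitary_of_fix {A B P : C} {k : A ⟶ P} {l : B ⟶ P}
    (h : IsComplementary k l) {V : P ⟶ P} (hV : IsPure V) (hk : k ≫ V = k) (hl : l ≫ V = l) :
    IsUnitary V := by
  have hk' : dag V ≫ dag k = dag k := by simpa using congrArg dag hk
  have hl' : dag V ≫ dag l = dag l := by simpa using congrArg dag hl
  have hc : IsCausal (dag V) := by
    have := h.isTotalPair (dag V) (𝟙 P) (by rw [← Category.assoc, hk', Category.id_comp])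
      (by rw [← Category.assoc, hl', Category.id_comp])
    rwa [Category.id_comp] at this
  simpa using (hV.dag.isUnitary_of_causal hc).dag

end Complements

section Superposition

variable {C : Type u} [Category.{v} C] [MonoidalCategory C] [SymmetricCategory C]
  [DaggerCategory C] [DaggerMonoidal C] [Discarding C] [HasZeroMorphisms C]
  [OperationalPrinciples C]

/-! ### Normalising pure states -/

/-- Every non-zero pure state is a pure scalar multiple of an isometric one. The point is that its
image `J` is trivial: if `p` is the state of `J` in question, then `p ⊗ p` has the same norm as a
multiple of `a ⊗ a`, for `a` an isometric pure state, so the two agree up to a unitary. -/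
lemma IsPure.exists_normalization {X : C} {ψ : 𝟙_ C ⟶ X} (hψ : IsPure ψ) (h0 : ψ ≠ 0) :
    ∃ (r : 𝟙_ C ⟶ 𝟙_ C) (φ : 𝟙_ C ⟶ X), IsPure r ∧ IsPure φ ∧ IsIsometry φ ∧ ψ = r ≫ φ := by
  obtain ⟨J, j, hj, hfac, hepi⟩ := exists_image ψ
  have hp : IsPure (ψ ≫ DaggerCategory.dag j) := hψ.comp hj.isPure.dag
  set p := ψ ≫ DaggerCategory.dag j with hpdef
  have hJ0 : ¬ IsZero J := fun h => h0 (by rw [← hfac, h.eq_of_tgt p 0, zero_comp])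
  have hJ : IsUnitary (discard J) := by
    by_contra hJ
    obtain ⟨a, b, ha, hb, haa, hbb, hab⟩ := exists_orthonormal (A := J)
      (fun h => h.elim hJ hJ0)
    set D := p ≫ DaggerCategory.dag p with hD
    have hDp : IsPure D := hp.comp hp.dag
    have hfp : IsPure (p ≫ DagTheory.prep J p) := hp.comp (hp.prep J)
    have hgp : IsPure (D ≫ a ≫ DagTheory.prep J a) := hDp.comp (ha.comp (ha.prep J))
    have hff : (p ≫ DagTheory.prep J p) ≫ DaggerCategory.dag (p ≫ DagTheory.prep J p) =
        D ≫ D := by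
      calc _ = (p ≫ DagTheory.prep J p ≫ DagTheory.test J (DaggerCategory.dag p)) ≫
            DaggerCategory.dag p := by simp
        _ = _ := by rw [state_prep_test, Category.assoc]
    have hgg : (D ≫ a ≫ DagTheory.prep J a) ≫
        DaggerCategory.dag (D ≫ a ≫ DagTheory.prep J a) = D ≫ D := by
      have hDD : DaggerCategory.dag D = D := by simp [hD]
      calc _ = D ≫ ((a ≫ DagTheory.prep J a) ≫ DaggerCategory.dag (a ≫ DagTheory.prep J a)) ≫
            DaggerCategory.dag D := by simp
        _ = _ := by rw [haa.comp (haa.prep J), Category.id_comp, hDD]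
    obtain ⟨U, hU, hU', hfg⟩ :=
      hfp.exists_unitary hgp ((hfp.cp hgp).1 (hff.trans hgg.symm))
    have hw : IsIsometry (a ≫ DagTheory.prep J b ≫ U) := haa.comp ((hbb.prep J).comp hU'.1)
    apply hw.state_ne_zero
    apply dag_eq_zero
    apply eq_zero_of_whiskerLeft_comp hepi (Y := J)
    have h1 : DagTheory.prep J p ≫ DaggerCategory.dag (a ≫ DagTheory.prep J b ≫ U) = 0 := by
      apply hepi
      rw [← Category.assoc, hfg]
      have e1 : DagTheory.prep J a ≫ DagTheory.test J (DaggerCategory.dag b) = 0 :=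
        prep_test_of_eq_zero J hab
      calc _ = D ≫ a ≫ DagTheory.prep J a ≫ (U ≫ DaggerCategory.dag U) ≫
            DagTheory.test J (DaggerCategory.dag b) ≫ DaggerCategory.dag a := by simp
        _ = D ≫ a ≫ (DagTheory.prep J a ≫ DagTheory.test J (DaggerCategory.dag b)) ≫
            DaggerCategory.dag a := by rw [hU'.1]; simp
        _ = 0 := by rw [e1]; simp
    rw [DagTheory.prep, Category.assoc] at h1
    rw [← cancel_epi (ρ_ J).inv, h1, comp_zero]
  obtain ⟨χ, hχ, hχ'⟩ := exists_causal_pure_state hJ0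
  have hχd := state_unique hJ hχ'
  have hχd' : discard J = DaggerCategory.dag χ := by rw [hχd, dag_dag]
  refine ⟨p ≫ DaggerCategory.dag χ, χ ≫ j, hp.comp hχ.dag, hχ.comp hj.isPure,
    (hχ.isometry_iff_causal.2 hχ').comp hj.isIsometry, ?_⟩
  rw [← hχd', hχd, Category.assoc, ← Category.assoc (discard J), hJ.1, Category.id_comp, hfac]

/-- A pure dilation of a pure state is obtained by adjoining a pure ancilla. -/
lemma IsPure.exists_pure_ancilla {D E : C} {f : 𝟙_ C ⟶ D} (hf : IsPure f) {s : 𝟙_ C ⟶ D ⊗ E}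
    (hs : IsPure s) (h : s ≫ DagTheory.test D (discard E) = f) (hE : ¬ IsZero E) :
    ∃ c : 𝟙_ C ⟶ E, IsPure c ∧ IsIsometry c ∧ s = f ≫ DagTheory.prep D c := by
  by_cases hf0 : f = 0
  · obtain ⟨c, hc, hc'⟩ := exists_isometric_pure_state hE
    refine ⟨c, hc, hc', ?_⟩
    rw [hf0, zero_comp]
    exact eq_zero_of_test_discard (h.trans hf0)
  obtain ⟨c, hc, hsc⟩ := hf.exists_eq_prep hf0 h
  obtain ⟨r, φ, hr, hφ, hφ', rfl⟩ := hf.exists_normalization hf0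
  -- `r ≫ c` is pure, so `c` may be replaced by the normalisation of `r ≫ c`.
  have hrc : r ≫ c = s ≫ DaggerCategory.dag φ ▷ E ≫ (λ_ E).hom := by
    calc r ≫ c = r ≫ c ≫ (λ_ E).inv ≫ (φ ≫ DaggerCategory.dag φ) ▷ E ≫ (λ_ E).hom := by
          rw [hφ']; simp
      _ = r ≫ (c ≫ (λ_ E).inv ≫ φ ▷ E) ≫ DaggerCategory.dag φ ▷ E ≫ (λ_ E).hom := by simp
      _ = _ := by rw [← state_prep_comm, hsc]; simp
  have hp : IsPure (r ≫ c) := by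
    rw [hrc]
    exact hs.comp ((hφ.dag.whiskerRight E).comp (leftUnitor_hom E))
  have hd : (r ≫ c) ≫ discard E = r := by
    rw [Category.assoc, causal_state_iff.1 hc, Category.comp_id]
  have h0 : r ≫ c ≠ 0 := by
    intro h0
    rw [h0, zero_comp] at hd
    exact hf0 (by rw [← hd, zero_comp])
  obtain ⟨r', c', hr', hc', hcc', hrr'⟩ := hp.exists_normalization h0
  have hr1 : r' = r := by
    rw [← hd, hrr', Category.assoc, causal_state_iff.1 (hc'.isometry_iff_causal.1 hcc'),
      Category.comp_id]
  refine ⟨c', hc', hcc', ?_⟩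
  rw [hsc, Category.assoc, Category.assoc, state_prep_comm, state_prep_comm, ← Category.assoc,
    hrr', hr1, Category.assoc]

/-! ### Superposing two states -/

/-- Given three orthonormal pure states, there is a pure morphism that fixes the first and takes
the last to the second: inside their span, a unitary that takes the second to the third sends the
other two into the complement of the third, where a further unitary adjusts the first. -/
lemma exists_rotation {X : C} {a b t : 𝟙_ C ⟶ X} (ha : IsPure a) (hb : IsPure b) (ht : IsPure t)
    (haa : IsIsometry a) (hbb : IsIsometry b) (htt : IsIsometry t) (hab : a ≫ dag b = 0)
    (hat : a ≫ dag t = 0) (hbt : b ≫ dag t = 0) :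
    ∃ W : X ⟶ X, IsPure W ∧ a ≫ W = a ∧ t ≫ W = b := by
  obtain ⟨P, p, hp, hp', hP, hap, hbp⟩ := exists_join ha hb haa hbb hab
  have hpt : p ≫ dag t = 0 := by
    apply hP.zero_epi <;> rw [← Category.assoc]
    · rw [hap, hat]
    · rw [hbp, hbt]
  obtain ⟨E, e, he, he', hE, hpe, hte⟩ := exists_join hp ht hp' htt hpt
  set a' := a ≫ dag p
  set b' := b ≫ dag p
  set k := p ≫ dag e
  set τ := t ≫ dag e
  have hak : a ≫ dag e = a' ≫ k := by rw [← hap, Category.assoc]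
  obtain ⟨U, hU, hU', hτ⟩ := hE.pure_right.exists_unitary (hP.pure_right.comp hE.pure_left)
    ((hE.pure_right.isometry_iff_causal.1 hE.isometry_right).trans
      (((hP.pure_right.comp hE.pure_left).isometry_iff_causal.1
        (hP.isometry_right.comp hE.isometry_left)).symm))
  have hUτ : U ≫ dag τ = dag (b' ≫ k) := by
    rw [hτ, dag_comp (b' ≫ k), ← Category.assoc, hU'.1, Category.id_comp]
  obtain ⟨x, hx⟩ := hE.symm.isComplement.factors (a' ≫ k ≫ U) (by
    rw [Category.assoc a', Category.assoc k, hUτ, dag_comp, ← Category.assoc k,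
      hE.isometry_left, Category.id_comp, hP.orthogonal])
  obtain ⟨y, hy⟩ := hE.symm.isComplement.factors (τ ≫ U) (by
    rw [Category.assoc, hUτ, dag_comp, ← Category.assoc, hE.symm.orthogonal, zero_comp])
  have hx1 : x = a' ≫ k ≫ U ≫ dag k := by
    rw [← Category.assoc k, ← Category.assoc, hx, Category.assoc, hE.isometry_left,
      Category.comp_id]
  have hy1 : y = τ ≫ U ≫ dag k := by
    rw [← Category.assoc, hy, Category.assoc, hE.isometry_left, Category.comp_id]
  have hgen : ∀ u v : 𝟙_ C ⟶ P, u ≫ dag v = (u ≫ k) ≫ dag (v ≫ k) := fun u v => by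
    rw [dag_comp, Category.assoc, ← Category.assoc k, hE.isometry_left, Category.id_comp]
  have hU2 : ∀ {u v : 𝟙_ C ⟶ E}, (u ≫ U) ≫ dag (v ≫ U) = u ≫ dag v := fun {u v} => by
    rw [dag_comp, Category.assoc, ← Category.assoc U, hU'.1, Category.id_comp]
  have hxx : IsIsometry x := by
    rw [IsIsometry, hgen, ← hx, ← Category.assoc, hU2, ← hgen]
    exact hP.isometry_left
  have hyy : IsIsometry y := by
    rw [IsIsometry, hgen, ← hy, hU2]
    exact hE.isometry_right
  have hyx : y ≫ dag x = 0 := by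
    rw [hgen, ← hx, ← hy, ← Category.assoc, hU2, dag_comp, ← Category.assoc,
      hE.symm.orthogonal, zero_comp]
  have hxp : IsPure x := by
    rw [hx1]
    exact hP.pure_left.comp (hE.pure_left.comp (hU.comp hE.pure_left.dag))
  have hyp : IsPure y := by
    rw [hy1]
    exact hE.pure_right.comp (hU.comp hE.pure_left.dag)
  obtain ⟨V, hV, hV', hVx⟩ := hP.pure_left.exists_unitary hxp
    ((hP.pure_left.isometry_iff_causal.1 hP.isometry_left).trans
      (hxp.isometry_iff_causal.1 hxx).symm)
  have hVy : y ≫ V = b' := by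
    refine hP.eq_right (hyp.comp hV) (hyy.comp hV'.1) ?_
    rw [hVx, dag_comp, Category.assoc, ← Category.assoc V, hV'.1, Category.id_comp, hyx]
  refine ⟨dag e ≫ U ≫ dag k ≫ V ≫ p,
    he.dag.comp (hU.comp (hE.pure_left.dag.comp (hV.comp hp))), ?_, ?_⟩
  · calc a ≫ dag e ≫ U ≫ dag k ≫ V ≫ p = ((a ≫ dag e) ≫ U ≫ dag k) ≫ V ≫ p := by simp
      _ = (x ≫ V) ≫ p := by rw [hak, hx1]; simp
      _ = a := by rw [← hVx, hap]
  · calc t ≫ dag e ≫ U ≫ dag k ≫ V ≫ p = (τ ≫ U ≫ dag k) ≫ V ≫ p := by simp [τ]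
      _ = (y ≫ V) ≫ p := by rw [hy1]; simp
      _ = b := by rw [hVy, hbp]

/-- A pure effect with value `1` on one orthonormal pair of pure states provides such an effect on
every other pair `a`, `b`: this pair is copied to `A ⊗ a`, `A ⊗ b`, and a rotation fixing `A ⊗ a`
takes `A ⊗ b` to `B ⊗ a`. -/
lemma exists_plus_of_effect {X Q : C} {A B : 𝟙_ C ⟶ X} {a b : 𝟙_ C ⟶ Q}
    (hA : IsPure A) (hB : IsPure B) (hAA : IsIsometry A) (hBB : IsIsometry B)
    (hAB : A ≫ dag B = 0) (ha : IsPure a) (hb : IsPure b) (haa : IsIsometry a)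
    (hbb : IsIsometry b) (hab : a ≫ dag b = 0) {u : X ⟶ 𝟙_ C} (hu : IsPure u)
    (hAu : A ≫ u = 𝟙 _) (hBu : B ≫ u = 𝟙 _) :
    ∃ e : Q ⟶ 𝟙_ C, IsPure e ∧ a ≫ e = 𝟙 _ ∧ b ≫ e = 𝟙 _ := by
  have hab0 : prep X a ≫ test X (dag b) = 0 := prep_test_of_eq_zero X hab
  have haa1 : prep X a ≫ test X (dag a) = 𝟙 X := prep_test_of_eq_id X haa
  obtain ⟨W, hW, hWa, hWt⟩ := exists_rotation (hA.comp (ha.prep X))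
    (hB.comp (ha.prep X)) (hA.comp (hb.prep X))
    (hAA.comp (haa.prep X)) (hBB.comp (haa.prep X))
    (hAA.comp (hbb.prep X))
    (by
      calc _ = A ≫ (prep X a ≫ test X (dag a)) ≫ dag B := by simp
        _ = 0 := by rw [haa1, Category.id_comp, hAB])
    (by
      calc _ = A ≫ (prep X a ≫ test X (dag b)) ≫ dag A := by simp
        _ = 0 := by rw [hab0, zero_comp, comp_zero])
    (by
      calc _ = B ≫ (prep X a ≫ test X (dag b)) ≫ dag A := by simp
        _ = 0 := by rw [hab0, zero_comp, comp_zero])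
  have hA1 : (A ≫ prep X a) ≫ test X (dag a) ≫ u = 𝟙 _ := by
    rw [Category.assoc, ← Category.assoc (prep X a), haa1, Category.id_comp, hAu]
  have hB1 : (B ≫ prep X a) ≫ test X (dag a) ≫ u = 𝟙 _ := by
    rw [Category.assoc, ← Category.assoc (prep X a), haa1, Category.id_comp, hBu]
  refine ⟨(λ_ Q).inv ≫ A ▷ Q ≫ W ≫ test X (dag a) ≫ u,
    (IsPure.leftUnitor_inv Q).comp ((hA.whiskerRight Q).comp (hW.comp
      ((ha.dag.test X).comp hu))), ?_, ?_⟩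
  · rw [← state_prep_comm_assoc, ← Category.assoc A, ← Category.assoc (A ≫ _), hWa, hA1]
  · rw [← state_prep_comm_assoc, ← Category.assoc A, ← Category.assoc (A ≫ _), hWt, hB1]

/-- There is a pure effect that takes the value `1` on both members of a complementary pair of pure
states. A purification of the completely mixed state provides such an effect on an orthonormal pair
`d₀ = |0⟩ ⊗ c₀`, `d₁ = |1⟩ ⊗ c₁`, and a rotation carries the original pair there. -/
lemma IsComplementary.exists_plus {Q : C} {a b : 𝟙_ C ⟶ Q} (h : IsComplementary a b) :
    ∃ e : Q ⟶ 𝟙_ C, IsPure e ∧ a ≫ e = 𝟙 _ ∧ b ≫ e = 𝟙 _ := by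
  obtain ⟨E, Ψ, hΨ, hΨd⟩ := exists_pure_dilation (dag (discard Q))
  have key : ∀ i : 𝟙_ C ⟶ Q, IsPure i → IsIsometry i → ∃ c : 𝟙_ C ⟶ E, IsPure c ∧
      IsIsometry c ∧ (i ≫ prep Q c) ≫ dag Ψ = 𝟙 _ := by
    intro i hi hi'
    have hc : IsPure (Ψ ≫ dag i ▷ E ≫ (λ_ E).hom) :=
      hΨ.comp ((hi.dag.whiskerRight E).comp (IsPure.leftUnitor_hom E))
    have hcc : IsIsometry (Ψ ≫ dag i ▷ E ≫ (λ_ E).hom) := by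
      rw [hc.isometry_iff_causal, causal_state_iff, Category.assoc, Category.assoc,
        ← test_effect_comm, ← Category.assoc, hΨd, ← dag_comp,
        causal_state_iff.1 (hi.isometry_iff_causal.1 hi'), dag_id]
    refine ⟨_, hc, hcc, ?_⟩
    apply dag_injective
    rw [dag_comp, dag_dag, dag_comp, dag_prep, test_effect_comm, dag_id, ← hcc]
    simp only [Category.assoc]
  obtain ⟨c, hc, hcc, hac⟩ := key a h.pure_left h.isometry_left
  obtain ⟨d, hd, hdd, hbd⟩ := key b h.pure_right h.isometry_right
  have hA : IsPure (a ≫ prep Q c) := h.pure_left.comp (hc.prep Q)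
  have hB : IsPure (b ≫ prep Q d) := h.pure_right.comp (hd.prep Q)
  have hAA : IsIsometry (a ≫ prep Q c) := h.isometry_left.comp (hcc.prep Q)
  have hBB : IsIsometry (b ≫ prep Q d) := h.isometry_right.comp (hdd.prep Q)
  have hAB : (a ≫ prep Q c) ≫ dag (b ≫ prep Q d) = 0 := by
    calc _ = (a ≫ prep Q c ≫ test Q (dag d)) ≫ dag b := by simp
      _ = 0 := by rw [state_prep_test, Category.assoc, h.orthogonal, comp_zero]
  exact exists_plus_of_effect hA hB hAA hBB hAB h.pure_left h.pure_right h.isometry_left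
    h.isometry_right h.orthogonal hΨ.dag hac hbd

lemma exists_plus_of_orthonormal {X : C} {a b : 𝟙_ C ⟶ X} (ha : IsPure a) (hb : IsPure b)
    (hab : IsOrthonormal a b) :
    ∃ e : X ⟶ 𝟙_ C, IsPure e ∧ a ≫ e = 𝟙 _ ∧ b ≫ e = 𝟙 _ := by
  obtain ⟨P, p, hp, -, hP, -, -⟩ := exists_join ha hb hab.1 hab.2.1 hab.2.2
  obtain ⟨e, he, h1, h2⟩ := hP.exists_plus
  exact ⟨dag p ≫ e, hp.dag.comp he, by rw [← Category.assoc, h1], by rw [← Category.assoc, h2]⟩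

/-- Pure states can be superposed: any two pure states of `D` are the values of a pure morphism on
a complementary pair. Conditioning and purification provide a pure morphism with values
`fᵢ ⊗ |i⟩ ⊗ cᵢ`, and the states `|i⟩ ⊗ cᵢ` are erased by a pure effect. -/
lemma IsComplementary.exists_pure_desc {Q D : C} {a b : 𝟙_ C ⟶ Q} (h : IsComplementary a b)
    {f g : 𝟙_ C ⟶ D} (hf : IsPure f) (hg : IsPure g) :
    ∃ x : Q ⟶ D, IsPure x ∧ a ≫ x = f ∧ b ≫ x = g := by
  obtain ⟨m, hma, hmb⟩ := OperationalPrinciples.conditioning a b h.isOrthonormal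
    (f ≫ prep D a) (g ≫ prep D b)
  obtain ⟨E, y, hy, rfl⟩ := exists_pure_dilation m
  by_cases hE : IsZero E
  · have hy0 : y = 0 := by
      apply eq_zero_of_discard
      rw [discard_tensor_eq_test, hE.eq_of_src (discard E) 0, test_zero, zero_comp, comp_zero]
    have h0 : ∀ {i : 𝟙_ C ⟶ Q} {w : 𝟙_ C ⟶ D}, IsIsometry i → 0 = w ≫ prep D i → 0 = w := by
      intro i w hi hw
      have := congrArg (· ≫ test D (dag i)) hw
      simp only [zero_comp, Category.assoc] at this
      rwa [prep_test_of_eq_id D hi, Category.comp_id] at this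
    rw [hy0, zero_comp, comp_zero] at hma hmb
    exact ⟨0, IsPure.zero _ _, by rw [comp_zero, h0 h.isometry_left hma],
      by rw [comp_zero, h0 h.isometry_right hmb]⟩
  obtain ⟨c, hc, hcc, hyc⟩ := (hf.comp (h.pure_left.prep D)).exists_pure_ancilla
    (h.pure_left.comp hy) (by rw [Category.assoc, hma]) hE
  obtain ⟨d, hd, hdd, hyd⟩ := (hg.comp (h.pure_right.prep D)).exists_pure_ancilla
    (h.pure_right.comp hy) (by rw [Category.assoc, hmb]) hE
  obtain ⟨e, he, hae, hbe⟩ := exists_plus_of_orthonormal (h.pure_left.comp (hc.prep Q))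
    (h.pure_right.comp (hd.prep Q)) ⟨h.isometry_left.comp (hcc.prep Q),
      h.isometry_right.comp (hdd.prep Q), by
        calc _ = (a ≫ prep Q c ≫ test Q (dag d)) ≫ dag b := by simp
          _ = 0 := by rw [state_prep_test, Category.assoc, h.orthogonal, comp_zero]⟩
  have hfin : ∀ {i : 𝟙_ C ⟶ Q} {w : 𝟙_ C ⟶ D} {c : 𝟙_ C ⟶ E},
      (i ≫ prep Q c) ≫ e = 𝟙 _ → i ≫ y = (w ≫ prep D i) ≫ prep (D ⊗ Q) c →
      i ≫ y ≫ (α_ D Q E).hom ≫ test D e = w := by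
    intro i w c hi hw
    rw [← Category.assoc, hw]
    calc _ = w ≫ (prep D i ≫ prep (D ⊗ Q) c ≫ (α_ D Q E).hom) ≫ test D e := by simp
      _ = w := by rw [prep_prep, prep_test_of_eq_id D hi, Category.comp_id]
  exact ⟨y ≫ (α_ D Q E).hom ≫ test D e,
    hy.comp ((IsPure.associator_hom D Q E).comp (he.test D)), hfin hae hyc, hfin hbe hyd⟩

end Superposition

section Biproducts

variable {C : Type u} [Category.{v} C] [MonoidalCategory C] [SymmetricCategory C]
  [DaggerCategory C] [DaggerMonoidal C] [Discarding C] [HasZeroMorphisms C]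
  [OperationalPrinciples C]

/-! ### Biproducts of two objects -/

lemma IsPure.eq_id_of_isometry {r : 𝟙_ C ⟶ 𝟙_ C} (hr : IsPure r) (hr' : IsIsometry r) :
    r = 𝟙 _ := by
  have h := causal_state_iff.1 (hr.isometry_iff_causal.1 hr')
  rwa [discard_unit, Category.comp_id] at h

/-- A non-zero state detects zero effects, as the unit object has no proper kernels. -/
lemma eq_zero_or_of_comp_state {A E : C} {x : A ⟶ 𝟙_ C} {s : 𝟙_ C ⟶ E} (h : x ≫ s = 0) :
    x = 0 ∨ s = 0 := by
  obtain ⟨K, k, hk⟩ := exists_kernel s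
  by_cases hK : IsZero K
  · obtain ⟨y, rfl⟩ := hk.factors x h
    exact Or.inl (by rw [hK.eq_of_tgt y 0, zero_comp])
  · obtain ⟨φ, hφ, hφ'⟩ := exists_isometric_pure_state hK
    have h1 := (hφ.comp hk.isPure).eq_id_of_isometry (hφ'.comp hk.isometry)
    right
    rw [← Category.id_comp s, ← h1, Category.assoc, hk.comp_eq_zero, comp_zero]

lemma eq_zero_or_of_comp_prep {A D E : C} {f : A ⟶ D} {s : 𝟙_ C ⟶ E} (h : f ≫ prep D s = 0) :
    f = 0 ∨ s = 0 := by
  obtain ⟨D', i, -, -⟩ := exists_pure_dual' D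
  obtain ⟨x, hx⟩ := (tensorLeftHomEquiv A D D' (𝟙_ C)).surjective (f ≫ (ρ_ D).inv)
  rw [prep, ← Category.assoc, ← hx, ← tensorLeftHomEquiv_naturality, transpose_eq_zero] at h
  refine (eq_zero_or_of_comp_state h).imp_left fun h0 => ?_
  rw [h0, transpose_eq_zero.2 rfl] at hx
  rw [← cancel_mono (ρ_ D).inv, ← hx, zero_comp]

variable (C) in
lemma exists_qubit : ∃ (Q : C) (a b : 𝟙_ C ⟶ Q), IsComplementary a b := by
  obtain ⟨A, hA⟩ := OperationalPrinciples.nontrivial (C := C)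
  obtain ⟨a, b, ha, hb, hab⟩ := exists_orthonormal hA
  obtain ⟨Q, p, -, -, hQ, -, -⟩ := exists_join ha hb hab.1 hab.2.1 hab.2.2
  exact ⟨Q, _, _, hQ⟩

/-- `Y ⊗ Q` has the existence property of a biproduct of two copies of `Y`: transposition reduces
this to the superposition of states. -/
lemma IsComplementary.exists_pure_desc_tensor {Q Y D : C} {a b : 𝟙_ C ⟶ Q}
    (h : IsComplementary a b) {f g : Y ⟶ D} (hf : IsPure f) (hg : IsPure g) :
    ∃ x : Y ⊗ Q ⟶ D, IsPure x ∧ prep Y a ≫ x = f ∧ prep Y b ≫ x = g := by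
  obtain ⟨Z, i, hη, hε⟩ := exists_pure_dual Y
  obtain ⟨x, hx, hax, hbx⟩ := h.exists_pure_desc
    (hη.transpose ((IsPure.rightUnitor_hom Y).comp hf))
    (hη.transpose ((IsPure.rightUnitor_hom Y).comp hg))
  refine ⟨(tensorLeftHomEquiv Q Z Y D).symm x, hε.transpose_symm hx, ?_, ?_⟩
  · rw [prep, Category.assoc, ← tensorLeftHomEquiv_symm_naturality, hax, Equiv.symm_apply_apply,
      Iso.inv_hom_id_assoc]
  · rw [prep, Category.assoc, ← tensorLeftHomEquiv_symm_naturality, hbx, Equiv.symm_apply_apply,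
      Iso.inv_hom_id_assoc]

/-- A complementary pair along which pure morphisms can be superposed. -/
structure IsPureBiproduct {A B P : C} (k : A ⟶ P) (l : B ⟶ P) : Prop
    extends IsComplementary k l where
  exists_desc : ∀ {D : C} {f : A ⟶ D} {g : B ⟶ D}, IsPure f → IsPure g →
    ∃ x : P ⟶ D, IsPure x ∧ k ≫ x = f ∧ l ≫ x = g

lemma isPureBiproduct_of_isZero {A B : C} (hA : IsZero A) :
    IsPureBiproduct (0 : A ⟶ B) (𝟙 B) where
  pure_left := IsPure.zero _ _
  pure_right := IsPure.id _
  isometry_left := hA.eq_of_src _ _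
  isometry_right := isIsometry_id B
  orthogonal := zero_comp
  zero_epi f _ h := by rwa [Category.id_comp] at h
  exists_desc {D f g} _ hg := ⟨g, hg, hA.eq_of_src _ _, Category.id_comp g⟩

lemma IsPureBiproduct.symm {A B P : C} {k : A ⟶ P} {l : B ⟶ P} (h : IsPureBiproduct k l) :
    IsPureBiproduct l k where
  toIsComplementary := h.toIsComplementary.symm
  exists_desc hf hg := by
    obtain ⟨x, hx, h1, h2⟩ := h.exists_desc hg hf
    exact ⟨x, hx, h2, h1⟩

/-- Two non-zero objects `A`, `B` embed in `(A ⊗ B) ⊗ Q` as `A ⊗ b ⊗ |0⟩` and `a ⊗ B ⊗ |1⟩`; their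
join is a biproduct. -/
lemma exists_pureBiproduct (A B : C) :
    ∃ (P : C) (k : A ⟶ P) (l : B ⟶ P), IsPureBiproduct k l := by
  by_cases hA : IsZero A
  · exact ⟨_, _, _, isPureBiproduct_of_isZero hA⟩
  by_cases hB : IsZero B
  · exact ⟨_, _, _, (isPureBiproduct_of_isZero hB).symm⟩
  obtain ⟨Q, q₀, q₁, hQ⟩ := exists_qubit C
  obtain ⟨a, ha, haa⟩ := exists_isometric_pure_state hA
  obtain ⟨b, hb, hbb⟩ := exists_isometric_pure_state hB
  obtain ⟨Y, i, j, hi, hj, hii, hjj⟩ : ∃ (Y : C) (i : A ⟶ Y) (j : B ⟶ Y), IsPure i ∧ IsPure j ∧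
      IsIsometry i ∧ IsIsometry j :=
    ⟨A ⊗ B, prep A b, prep B a ≫ (β_ B A).hom, hb.prep A, (ha.prep B).comp (IsPure.braiding B A),
      hbb.prep A, (haa.prep B).comp (by simp [IsIsometry, DaggerMonoidal.dag_braiding])⟩
  obtain ⟨P, p, hp, -, hP, hkp, hlp⟩ := exists_join (hi.comp (hQ.pure_left.prep Y))
    (hj.comp (hQ.pure_right.prep Y)) (hii.comp (hQ.isometry_left.prep Y))
    (hjj.comp (hQ.isometry_right.prep Y)) (by
      have h0 : prep Y q₀ ≫ test Y (dag q₁) = 0 := prep_test_of_eq_zero Y hQ.orthogonal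
      calc _ = i ≫ (prep Y q₀ ≫ test Y (dag q₁)) ≫ dag j := by simp
        _ = 0 := by rw [h0, zero_comp, comp_zero])
  refine ⟨P, _, _, hP, fun {D f g} hf hg => ?_⟩
  obtain ⟨x, hx, h1, h2⟩ := hQ.exists_pure_desc_tensor (hi.dag.comp hf) (hj.dag.comp hg)
  refine ⟨p ≫ x, hp.comp hx, ?_, ?_⟩
  · rw [← Category.assoc, hkp, Category.assoc, h1, hii.cancel]
  · rw [← Category.assoc, hlp, Category.assoc, h2, hjj.cancel]

lemma IsComplementary.eq_left_of_prep {Q A D : C} {a b c : 𝟙_ C ⟶ Q} (h : IsComplementary a b)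
    (hc : IsPure c) (hc' : IsIsometry c) {f : A ⟶ D} (hf : f ≠ 0)
    (hac : f ≫ prep D a = f ≫ prep D c) : c = a := by
  apply h.symm.eq_right hc hc'
  have h1 := congrArg (· ≫ D ◁ dag b) hac
  simp only [Category.assoc, prep_whiskerLeft, h.orthogonal, prep_zero, comp_zero] at h1
  exact (eq_zero_or_of_comp_prep h1.symm).resolve_left hf

/-- Pure morphisms out of a biproduct are determined by their restrictions up to a phase. Recording
the summand in an ancilla `Q` turns the two morphisms into purifications of the same morphism, which
differ by a unitary on `Q`; this unitary fixes both basis states, and the ancilla is then erased by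
an effect that does not distinguish these. -/
lemma IsPureBiproduct.exists_phase {A B P D : C} {k : A ⟶ P} {l : B ⟶ P}
    (h : IsPureBiproduct k l) {x y : P ⟶ D} (hx : IsPure x) (hy : IsPure y)
    (hk : k ≫ x = k ≫ y) (hl : l ≫ x = l ≫ y) :
    ∃ U : P ⟶ P, IsPure U ∧ k ≫ U = k ∧ l ≫ U = l ∧ y = U ≫ x := by
  by_cases hk0 : k ≫ x = 0
  · exact ⟨𝟙 P, IsPure.id P, Category.comp_id k, Category.comp_id l, by
      rw [Category.id_comp, h.symm.ext_of_comp_right hk0 (hk.symm.trans hk0) hl]⟩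
  by_cases hl0 : l ≫ x = 0
  · exact ⟨𝟙 P, IsPure.id P, Category.comp_id k, Category.comp_id l, by
      rw [Category.id_comp, h.ext_of_comp_right hl0 (hl.symm.trans hl0) hk]⟩
  obtain ⟨Q, a, b, hQ⟩ := exists_qubit C
  obtain ⟨e, he, hae, hbe⟩ := hQ.exists_plus
  obtain ⟨δ, hδ, hkδ, hlδ⟩ := h.exists_desc (h.pure_left.comp (hQ.pure_left.prep P))
    (h.pure_right.comp (hQ.pure_right.prep P))
  have hkδ' : ∀ {w : P ⟶ D}, k ≫ δ ≫ w ▷ Q = (k ≫ w) ≫ prep D a := fun {w} => by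
    rw [← Category.assoc, hkδ, Category.assoc, prep_naturality, Category.assoc]
  have hlδ' : ∀ {w : P ⟶ D}, l ≫ δ ≫ w ▷ Q = (l ≫ w) ≫ prep D b := fun {w} => by
    rw [← Category.assoc, hlδ, Category.assoc, prep_naturality, Category.assoc]
  have hab0 : prep D a ≫ test D (dag b) = 0 := prep_test_of_eq_zero D hQ.orthogonal
  have hba0 : prep D b ≫ test D (dag a) = 0 := prep_test_of_eq_zero D hQ.symm.orthogonal
  have hkb : ∀ {w : P ⟶ D}, k ≫ (δ ≫ w ▷ Q) ≫ test D (dag b) = 0 := fun {w} => by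
    rw [← Category.assoc, hkδ', Category.assoc, hab0, comp_zero]
  have hla : ∀ {w : P ⟶ D}, l ≫ (δ ≫ w ▷ Q) ≫ test D (dag a) = 0 := fun {w} => by
    rw [← Category.assoc, hlδ', Category.assoc, hba0, comp_zero]
  obtain ⟨V, hV, hV', hyx⟩ := (hδ.comp (hy.whiskerRight Q)).exists_unitary_ancilla
    (hδ.comp (hx.whiskerRight Q)) (IsTotalPair.whiskerLeft hQ.isTotalPair_states
      (h.ext_of_comp_right hla hla (by
        rw [← Category.assoc k (δ ≫ y ▷ Q), ← Category.assoc k (δ ≫ x ▷ Q), hkδ', hkδ', hk]))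
      (h.symm.ext_of_comp_right hkb hkb (by
        rw [← Category.assoc l (δ ≫ y ▷ Q), ← Category.assoc l (δ ≫ x ▷ Q), hlδ', hlδ', hl])))
  have haV : a ≫ V = a := by
    refine hQ.eq_left_of_prep (hQ.pure_left.comp hV) (hQ.isometry_left.comp hV'.1) hk0 ?_
    calc (k ≫ x) ≫ prep D a = k ≫ δ ≫ y ▷ Q := by rw [hkδ', hk]
      _ = (k ≫ δ ≫ x ▷ Q) ≫ D ◁ V := by rw [hyx]; simp only [Category.assoc]
      _ = (k ≫ x) ≫ prep D (a ≫ V) := by rw [hkδ', Category.assoc, prep_whiskerLeft]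
  have hbV : b ≫ V = b := by
    refine hQ.symm.eq_left_of_prep (hQ.pure_right.comp hV) (hQ.isometry_right.comp hV'.1) hl0 ?_
    calc (l ≫ x) ≫ prep D b = l ≫ δ ≫ y ▷ Q := by rw [hlδ', hl]
      _ = (l ≫ δ ≫ x ▷ Q) ≫ D ◁ V := by rw [hyx]; simp only [Category.assoc]
      _ = (l ≫ x) ≫ prep D (b ≫ V) := by rw [hlδ', Category.assoc, prep_whiskerLeft]
  have hfix : ∀ {e' : Q ⟶ 𝟙_ C}, a ≫ e' = 𝟙 _ → b ≫ e' = 𝟙 _ →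
      k ≫ δ ≫ test P e' = k ∧ l ≫ δ ≫ test P e' = l := fun h1 h2 => by
    constructor
    · rw [← Category.assoc, hkδ, Category.assoc, prep_test_of_eq_id P h1, Category.comp_id]
    · rw [← Category.assoc, hlδ, Category.assoc, prep_test_of_eq_id P h2, Category.comp_id]
  obtain ⟨hk1, hl1⟩ := hfix hae hbe
  obtain ⟨hk2, hl2⟩ := hfix (e' := V ≫ e) (by rw [← Category.assoc, haV, hae])
    (by rw [← Category.assoc, hbV, hbe])
  have hWp : IsPure (δ ≫ test P e) := hδ.comp (he.test P)
  have hW : IsUnitary (δ ≫ test P e) := h.isUnitary_of_fix hWp hk1 hl1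
  have hWxy : (δ ≫ test P e) ≫ y = (δ ≫ test P (V ≫ e)) ≫ x := by
    have := congrArg (· ≫ test D e) hyx
    simp only [Category.assoc, whiskerLeft_test, test_naturality] at this
    simpa using this
  generalize δ ≫ test P e = W at *
  have hfixdag : ∀ {M : C} {m : M ⟶ P}, m ≫ W = m → m ≫ dag W = m := fun {M m} hm => by
    conv_lhs => rw [← hm]
    rw [Category.assoc, hW.1, Category.comp_id]
  refine ⟨dag W ≫ δ ≫ test P (V ≫ e), hWp.dag.comp (hδ.comp ((hV.comp he).test P)), ?_, ?_, ?_⟩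
  · rw [← Category.assoc, hfixdag hk1, hk2]
  · rw [← Category.assoc, hfixdag hl1, hl2]
  · rw [Category.assoc, ← hWxy, ← Category.assoc, hW.2, Category.id_comp]

/-! ### Biproducts of finite families -/

/-- A biproduct of a family of objects with respect to pure morphisms: pairwise orthogonal pure
isometries that together determine discarding, along which pure morphisms extend, uniquely up to a
pure endomorphism fixing all coprojections. -/
structure IsPureBiproductFamily {ι : Type} {A : ι → C} {P : C} (κ : ∀ i, A i ⟶ P) : Prop where
  pure : ∀ i, IsPure (κ i)
  isometry : ∀ i, IsIsometry (κ i)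
  orthogonal : ∀ i j, i ≠ j → κ i ≫ dag (κ j) = 0
  total : ∀ {B : C} (f g : B ⟶ P), (∀ i, f ≫ dag (κ i) ≫ discard (A i) =
    g ≫ dag (κ i) ≫ discard (A i)) → f ≫ discard P = g ≫ discard P
  exists_desc : ∀ {D : C} (f : ∀ i, A i ⟶ D), (∀ i, IsPure (f i)) →
    ∃ x : P ⟶ D, IsPure x ∧ ∀ i, κ i ≫ x = f i
  exists_phase : ∀ {D : C} (x y : P ⟶ D), IsPure x → IsPure y → (∀ i, κ i ≫ x = κ i ≫ y) →
    ∃ U : P ⟶ P, IsPure U ∧ (∀ i, κ i ≫ U = κ i) ∧ y = U ≫ x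

variable (C) in
lemma exists_isZero : ∃ Z : C, IsZero Z := by
  obtain ⟨K, k, hk⟩ := exists_kernel (𝟙 (𝟙_ C))
  refine ⟨K, (IsZero.iff_id_eq_zero K).2 ?_⟩
  have h0 : k = 0 := by rw [← hk.comp_eq_zero, Category.comp_id]
  rw [← hk.isometry, h0, zero_comp]

/-- Finite biproducts are iterated binary ones. A phase of the part `R` of a biproduct with summands
`A 0` and `R` extends to the whole, so that uniqueness up to a phase is inherited. -/
lemma exists_pureBiproductFamily : ∀ (n : ℕ) (A : Fin n → C),
    ∃ (P : C) (κ : ∀ i, A i ⟶ P), IsPureBiproductFamily κ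
  | 0, A => by
    obtain ⟨Z, hZ⟩ := exists_isZero C
    refine ⟨Z, fun i => i.elim0, fun i => i.elim0, fun i => i.elim0, fun i => i.elim0,
      fun f g _ => ?_, fun f _ => ⟨0, IsPure.zero _ _, fun i => i.elim0⟩,
      fun x y _ _ _ => ⟨𝟙 Z, IsPure.id Z, fun i => i.elim0, hZ.eq_of_src _ _⟩⟩
    rw [hZ.eq_of_tgt f g]
  | n + 1, A => by
    obtain ⟨R, κ, hκ⟩ := exists_pureBiproductFamily n (fun i => A i.succ)
    obtain ⟨P, k, l, h⟩ := exists_pureBiproduct (A 0) R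
    refine ⟨P, Fin.cases k (fun i => κ i ≫ l), ?_, ?_, ?_, ?_, ?_, ?_⟩
    · exact Fin.cases h.pure_left fun i => (hκ.pure i).comp h.pure_right
    · exact Fin.cases h.isometry_left fun i => (hκ.isometry i).comp h.isometry_right
    · refine Fin.cases (Fin.cases (fun h => (h rfl).elim) fun j _ => ?_)
        (fun i => Fin.cases (fun _ => ?_) fun j hij => ?_)
      · change k ≫ dag (κ j ≫ l) = 0
        rw [dag_comp, ← Category.assoc, h.orthogonal, zero_comp]
      · change (κ i ≫ l) ≫ dag k = 0
        rw [Category.assoc, h.symm.orthogonal, comp_zero]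
      · change (κ i ≫ l) ≫ dag (κ j ≫ l) = 0
        rw [dag_comp, Category.assoc, h.isometry_right.cancel]
        exact hκ.orthogonal i j fun hne => hij (congrArg Fin.succ hne)
    · intro B f g hfg
      refine h.isTotalPair f g (hfg 0) ?_
      rw [← Category.assoc, ← Category.assoc]
      refine hκ.total _ _ fun i => ?_
      have := hfg i.succ
      change f ≫ dag (κ i ≫ l) ≫ _ = g ≫ dag (κ i ≫ l) ≫ _ at this
      simpa using this
    · intro D f hf
      obtain ⟨y, hy, hy'⟩ := hκ.exists_desc (fun i => f i.succ) fun i => hf i.succ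
      obtain ⟨x, hx, hkx, hlx⟩ := h.exists_desc (hf 0) hy
      refine ⟨x, hx, Fin.cases hkx fun i => ?_⟩
      change (κ i ≫ l) ≫ x = _
      rw [Category.assoc, hlx, hy']
    · intro D x y hx hy hxy
      obtain ⟨U, hU, hU', hyx⟩ := hκ.exists_phase (l ≫ x) (l ≫ y) (h.pure_right.comp hx)
        (h.pure_right.comp hy) fun i => by
          have := hxy i.succ
          change (κ i ≫ l) ≫ x = (κ i ≫ l) ≫ y at this
          simpa using this
      obtain ⟨V, hV, hkV, hlV⟩ := h.exists_desc h.pure_left (hU.comp h.pure_right)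
      obtain ⟨W, hW, hkW, hlW, hyW⟩ := h.exists_phase (hV.comp hx) hy
        (by rw [← Category.assoc, hkV]; exact hxy 0)
        (by rw [← Category.assoc, hlV, Category.assoc, hyx])
      refine ⟨W ≫ V, hW.comp hV, Fin.cases ?_ fun i => ?_, by rw [hyW, Category.assoc]⟩
      · change k ≫ W ≫ V = k
        rw [← Category.assoc, hkW, hkV]
      · change (κ i ≫ l) ≫ W ≫ V = κ i ≫ l
        rw [Category.assoc, ← Category.assoc l, hlW, hlV, ← Category.assoc, hU']

/-- Phases are unitary: their daggers are causal, since the coprojections determine discarding. -/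
lemma IsPureBiproductFamily.isUnitary_of_phase {ι : Type} {A : ι → C} {P : C} {κ : ∀ i, A i ⟶ P}
    (h : IsPureBiproductFamily κ) {U : P ⟶ P} (hU : IsPure U) (hκ : ∀ i, κ i ≫ U = κ i) :
    IsUnitary U := by
  have hc : IsCausal (dag U) := by
    have := h.total (dag U) (𝟙 P) fun i => by
      rw [← Category.assoc, ← dag_comp, hκ, Category.id_comp]
    rwa [Category.id_comp] at this
  simpa using (hU.dag.isUnitary_of_causal hc).dag

/-! ### Positive diagonal morphisms -/

/-- If a pure morphism `g` out of a biproduct has orthogonal restrictions, then its norm `⊤ ∘ g`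
depends on the norms of the restrictions only. With an ancilla recording the summand, the norm of
`g` does not change, by totality on the codomain of `g`, and then totality on the ancilla applies. -/
lemma IsPureBiproduct.discard_eq_of_orthogonal {A B P Y Z : C} {k : A ⟶ P} {l : B ⟶ P}
    (h : IsPureBiproduct k l) {g : P ⟶ Y} {g' : P ⟶ Z} (hg : IsPure g) (hg' : IsPure g')
    (ho : Orthogonal (k ≫ g) (l ≫ g)) (ho' : Orthogonal (k ≫ g') (l ≫ g'))
    (hk : (k ≫ g) ≫ discard Y = (k ≫ g') ≫ discard Z)
    (hl : (l ≫ g) ≫ discard Y = (l ≫ g') ≫ discard Z) :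
    g ≫ discard Y = g' ≫ discard Z := by
  obtain ⟨Q, a, b, hQ⟩ := exists_qubit C
  have key : ∀ {Y : C} {g : P ⟶ Y}, IsPure g → Orthogonal (k ≫ g) (l ≫ g) →
      ∃ x : P ⟶ Q, x ≫ discard Q = g ≫ discard Y ∧
        k ≫ x = ((k ≫ g) ≫ discard Y) ≫ a ∧ l ≫ x = ((l ≫ g) ≫ discard Y) ≫ b := by
    intro Y g hg ho
    obtain ⟨G, hG, hkG, hlG⟩ := h.exists_desc ((h.pure_left.comp hg).comp (hQ.pure_left.prep Y))
      ((h.pure_right.comp hg).comp (hQ.pure_right.prep Y))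
    refine ⟨G ≫ discard Y ▷ Q ≫ (λ_ Q).hom, ?_, ?_, ?_⟩
    · have hd : ∀ {i : 𝟙_ C ⟶ Q}, IsPure i → IsIsometry i →
          prep Y i ≫ test Y (discard Q) = 𝟙 Y := fun hi hi' =>
        prep_test_of_eq_id Y (causal_state_iff.1 (hi.isometry_iff_causal.1 hi'))
      set f := G ≫ test Y (discard Q) with hf
      have hkf : k ≫ f = k ≫ g := by
        rw [hf, ← Category.assoc, hkG, Category.assoc, hd hQ.pure_left hQ.isometry_left,
          Category.comp_id]
      have hlf : l ≫ f = l ≫ g := by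
        rw [hf, ← Category.assoc, hlG, Category.assoc, hd hQ.pure_right hQ.isometry_right,
          Category.comp_id]
      obtain ⟨M, c, hc⟩ := exists_kernel (dag (k ≫ g))
      obtain ⟨N, m, hm⟩ := exists_kernel (dag c)
      have hkc : (k ≫ g) ≫ dag c = 0 := by simpa using congrArg dag hc.comp_eq_zero
      have hlm : (l ≫ g) ≫ dag m = 0 := by
        obtain ⟨y, hy⟩ := hc.factors (l ≫ g) ho.symm
        have : c ≫ dag m = 0 := by simpa using congrArg dag hm.comp_eq_zero
        rw [hy, Category.assoc, this, comp_zero]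
      have h1 : f ≫ dag c = g ≫ dag c := by
        apply h.symm.ext_of_comp_right <;> simp only [← Category.assoc, hkf, hlf, hkc]
      have h2 : f ≫ dag m = g ≫ dag m := by
        apply h.ext_of_comp_right <;> simp only [← Category.assoc, hkf, hlf, hlm]
      have h3 := OperationalPrinciples.kernels.causally_complemented c m ⟨_, _, hc⟩ hm f g
        (by rw [← Category.assoc, h1, Category.assoc])
        (by rw [← Category.assoc, h2, Category.assoc])
      rw [← h3, hf, Category.assoc, Category.assoc, Category.assoc, ← test_effect_comm]
    · rw [← Category.assoc, hkG, Category.assoc, prep_naturality_assoc]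
      simp [prep, unitors_equal]
    · rw [← Category.assoc, hlG, Category.assoc, prep_naturality_assoc]
      simp [prep, unitors_equal]
  obtain ⟨x, hx, hkx, hlx⟩ := key hg ho
  obtain ⟨y, hy, hky, hly⟩ := key hg' ho'
  rw [← hx, ← hy]
  apply hQ.isTotalPair_states
  · apply h.ext_of_comp_right
    · rw [← Category.assoc, hlx, Category.assoc, hQ.symm.orthogonal, comp_zero]
    · rw [← Category.assoc, hly, Category.assoc, hQ.symm.orthogonal, comp_zero]
    · rw [← Category.assoc, ← Category.assoc, hkx, hky, hk]
  · apply h.symm.ext_of_comp_right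
    · rw [← Category.assoc, hkx, Category.assoc, hQ.orthogonal, comp_zero]
    · rw [← Category.assoc, hky, Category.assoc, hQ.orthogonal, comp_zero]
    · rw [← Category.assoc, ← Category.assoc, hlx, hly, hl]

/-- Positive diagonal morphisms are determined by their diagonal entries. -/
lemma IsPureBiproduct.eq_of_diagonal {A B P Y Z : C} {k : A ⟶ P} {l : B ⟶ P}
    (h : IsPureBiproduct k l) {g : P ⟶ Y} {g' : P ⟶ Z} (hg : IsPure g) (hg' : IsPure g')
    {u : A ⟶ A} {w : B ⟶ B}
    (hk : k ≫ g ≫ dag g = u ≫ k) (hk' : k ≫ g' ≫ dag g' = u ≫ k)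
    (hl : l ≫ g ≫ dag g = w ≫ l) (hl' : l ≫ g' ≫ dag g' = w ≫ l) :
    g ≫ dag g = g' ≫ dag g' := by
  rw [hg.cp hg']
  have ho : ∀ {Y : C} {g : P ⟶ Y}, k ≫ g ≫ dag g = u ≫ k → Orthogonal (k ≫ g) (l ≫ g) := by
    intro Y g hk
    calc (k ≫ g) ≫ dag (l ≫ g) = (k ≫ g ≫ dag g) ≫ dag l := by simp
      _ = 0 := by rw [hk, Category.assoc, h.orthogonal, comp_zero]
  have hn : ∀ {Y M : C} {g : P ⟶ Y} {m : M ⟶ P} {u : M ⟶ M}, IsIsometry m →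
      m ≫ g ≫ dag g = u ≫ m → (m ≫ g) ≫ dag (m ≫ g) = u := by
    intro Y M g m u hm hu
    calc (m ≫ g) ≫ dag (m ≫ g) = (m ≫ g ≫ dag g) ≫ dag m := by simp
      _ = u := by rw [hu, Category.assoc, hm, Category.comp_id]
  refine h.discard_eq_of_orthogonal hg hg' (ho hk) (ho hk') ?_ ?_
  · rw [← (h.pure_left.comp hg).cp (h.pure_left.comp hg'), hn h.isometry_left hk,
      hn h.isometry_left hk']
  · rw [← (h.pure_right.comp hg).cp (h.pure_right.comp hg'), hn h.isometry_right hl,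
      hn h.isometry_right hl']

end Biproducts

/-! ### The category of pure morphisms -/

section PureCat

variable {C : Type u} [Category.{v} C] [MonoidalCategory C] [SymmetricCategory C]
  [DaggerCategory C] [DaggerMonoidal C] [Discarding C] [HasZeroMorphisms C]
  [OperationalPrinciples C]

/-- Phased dagger biproducts in the category of pure morphisms, with unitary phases. -/
lemma exists_phasedDaggerBiproduct {n : ℕ} (A : Fin n → PureCat C) :
    ∃ B : PhasedDaggerBiproduct A, ∀ U : B.obj ⟶ B.obj, IsPhase B.κ U → IsUnitary U := by
  obtain ⟨P, κ, h⟩ := exists_pureBiproductFamily n fun i => (A i).obj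
  have hu : ∀ {U : (⟨P⟩ : PureCat C) ⟶ ⟨P⟩}, (∀ i, κ i ≫ U.hom = κ i) → IsUnitary U.hom :=
    fun {U} hU => h.isUnitary_of_phase U.property hU
  refine ⟨{
    obj := ⟨P⟩
    κ := fun i => ⟨κ i, h.pure i⟩
    isometry := fun i => WideSubcategory.hom_ext _ (h.isometry i)
    orthogonal := fun i j hij => WideSubcategory.hom_ext _ (h.orthogonal i j hij)
    exists_desc := fun {D} f => by
      obtain ⟨x, hx, hx'⟩ := h.exists_desc (fun i => (f i).hom) fun i => (f i).property
      exact ⟨⟨x, hx⟩, fun i => WideSubcategory.hom_ext _ (hx' i)⟩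
    unique_up_to_phase := fun {D} x y hxy => by
      obtain ⟨U, hU, hU', hxy'⟩ := h.exists_phase x.hom y.hom x.property y.property
        fun i => congrArg (·.hom) (hxy i)
      exact ⟨⟨U, hU⟩, fun i => WideSubcategory.hom_ext _ (hU' i),
        WideSubcategory.hom_ext _ hxy'⟩
    dag_phase := fun U hU i => WideSubcategory.hom_ext _ ?_ }, fun U hU => ?_⟩
  · have hU' : ∀ i, κ i ≫ U.hom = κ i := fun i => congrArg (·.hom) (hU i)
    change κ i ≫ dag U.hom = κ i
    conv_lhs => rw [← hU' i]
    rw [Category.assoc, (hu hU').1, Category.comp_id]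
  · have h' := hu fun i => congrArg (·.hom) (hU i)
    exact ⟨WideSubcategory.hom_ext _ h'.1, WideSubcategory.hom_ext _ h'.2⟩

/-- Every binary phased dagger biproduct of pure morphisms is a biproduct of a complementary pair;
it detects mixed zero morphisms since it detects their purifications. -/
lemma BinaryPhasedDaggerBiproduct.isPureBiproduct {A B : PureCat C}
    (P : BinaryPhasedDaggerBiproduct A B) :
    IsPureBiproduct (A := A.obj) (B := B.obj) (P := P.obj.obj) (P.κ 0).hom (P.κ 1).hom where
  pure_left := (P.κ 0).property
  pure_right := (P.κ 1).property
  isometry_left := congrArg InducedWideCategory.Hom.hom (P.isometry 0)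
  isometry_right := congrArg InducedWideCategory.Hom.hom (P.isometry 1)
  orthogonal := congrArg (·.hom) (P.orthogonal 0 1 (by decide))
  zero_epi {D} f h0 h1 := by
    obtain ⟨E, g, hg, rfl⟩ := exists_pure_dilation f
    have h0' : (P.κ 0).hom ≫ g = 0 := eq_zero_of_test_discard (by rw [Category.assoc]; exact h0)
    have h1' : (P.κ 1).hom ≫ g = 0 := eq_zero_of_test_discard (by rw [Category.assoc]; exact h1)
    obtain ⟨U, -, hU⟩ := P.unique_up_to_phase (D := ⟨D ⊗ E⟩) 0 ⟨g, hg⟩ (by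
      intro i
      rw [comp_zero]
      fin_cases i
      · exact (WideSubcategory.hom_ext _ h0').symm
      · exact (WideSubcategory.hom_ext _ h1').symm)
    rw [comp_zero] at hU
    have hg0 : g = 0 := congrArg (·.hom) hU
    rw [hg0, zero_comp]
  exists_desc {D f g} hf hg := by
    obtain ⟨x, hx⟩ := P.exists_desc (D := ⟨D⟩)
      (Fin.cases ⟨f, hf⟩ (Fin.cases ⟨g, hg⟩ fun i => i.elim0))
    exact ⟨x.hom, x.property, congrArg (·.hom) (hx 0), congrArg (·.hom) (hx 1)⟩

lemma pureCat_positive_cancellation {A B : PureCat C} (P : BinaryPhasedDaggerBiproduct A B)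
    {U p q : P.obj ⟶ P.obj} (hU : IsPhase P.κ U) (hp : IsPositive p) (hq : IsPositive q)
    (hpd : IsDiagonal P P p) (hpq : p = U ≫ q) : p = q := by
  obtain ⟨Y, g, hg⟩ := hp
  obtain ⟨Z, g', hg'⟩ := hq
  obtain ⟨u, hu⟩ := hpd 0
  obtain ⟨w, hw⟩ := hpd 1
  have hκ : ∀ i, P.κ i ≫ p = P.κ i ≫ q := fun i => by
    rw [hpq, ← Category.assoc, hU i]
  have hu' := (hκ 0).symm.trans hu
  have hw' := (hκ 1).symm.trans hw
  rw [hg] at hu hw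
  rw [hg'] at hu' hw'
  rw [hg, hg']
  exact WideSubcategory.hom_ext _ (P.isPureBiproduct.eq_of_diagonal g.property g'.property
    (congrArg (·.hom) hu) (congrArg (·.hom) hu') (congrArg (·.hom) hw) (congrArg (·.hom) hw'))

variable (C) in
lemma pureCat_superpositionProperties : SuperpositionProperties (PureCat C) where
  zero_tensor f := WideSubcategory.hom_ext _ (OperationalPrinciples.zero_tensor f.hom)
  compact A := by
    obtain ⟨D, cup, h, hp⟩ :=
      IsDaggerCompactSubcategory.exists_cup (P := pureMorphisms C) A.obj
    exact ⟨⟨D⟩, ⟨cup, hp⟩, ⟨WideSubcategory.hom_ext _ h.snake, WideSubcategory.hom_ext _ h.snake'⟩⟩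
  state_inhabited A hA := by
    have hA' : ¬ IsZero A.obj := fun h => hA ((IsZero.iff_id_eq_zero A).2
      (WideSubcategory.hom_ext _ ((IsZero.iff_id_eq_zero A.obj).1 h)))
    obtain ⟨ψ, hψ, hψ'⟩ := exists_isometric_pure_state hA'
    exact ⟨⟨ψ, hψ⟩, WideSubcategory.hom_ext _ hψ'⟩
  finite_biproducts n A := ⟨(exists_phasedDaggerBiproduct A).choose⟩
  positive_cancellation P _ _ _ hU hp hq hpd _ hpq :=
    pureCat_positive_cancellation P hU hp hq hpd hpq

end PureCat

end DagTheory

theorem corollary6p5 (C : Type u) [Category.{v} C] [MonoidalCategory C] [SymmetricCategory C]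
    [DagTheory.DaggerCategory C] [DagTheory.DaggerMonoidal C] [DagTheory.Discarding C]
    [HasZeroMorphisms C] [DagTheory.OperationalPrinciples C] :
    (∃ B : DagTheory.BinaryPhasedDaggerBiproduct
        (𝟙_ (DagTheory.PureCat C)) (𝟙_ (DagTheory.PureCat C)),
      ∀ U : B.obj ⟶ B.obj, DagTheory.IsPhase B.κ U → DagTheory.IsUnitary U) ∧
    DagTheory.SuperpositionProperties (DagTheory.PureCat C) :=
  ⟨DagTheory.exists_phasedDaggerBiproduct _, DagTheory.pureCat_superpositionProperties C⟩
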